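/- Let $0<\nu<1$. A closed set $\Omega\subset\mathbb R$ is called *$\nu$-porous on scales $\alpha_0$ to $\alpha_1$* ($0<\alpha_0\le\alpha_1$) if every interval $I\subset\mathbb R$ of length $|I|\in[\alpha_0,\alpha_1]$ has a subinterval $J\subset I$ with $|J|=\nu|I|$ and $J\cap\Omega=\emptyset$. For $f\in L^2(\mathbb R)$ (complex valued) let $\widehat f(\xi)=\int_{\mathbb R}e^{-ix\xi}f(x)\,dx$ denote its Fourier transform (extended to $L^2$). **Proposition.** For every $\nu\in(0,1)$ there exists $c=c(\nu)>0$, depending only on $\nu$, such that the following holds. Let $h>0$ and $K\in\mathbb N_0$ satisfy $2^{-K-1}\le h\le 2^{-K}$, and let $X,Y\subset[0,1]$ be closed sets which are $\nu$-porous on scales $h$ to $1$. Let $k\in\{0,1,\dots,K\}$. For each $j\in\mathbb Z$ let $I'_j$ be an interval with $$I'_j\subset[2^{-k}j,2^{-k}(j+1)],\qquad |I'_j|=2^{-k}\nu,\qquad I'_j\cap X=\emptyset,$$ and put $U'_k:=\bigcup_{j\in\mathbb Z}I'_j$. (Such intervals exist because $X$ is $\nu$-porous on scales $h$ to $1$;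 the constant $c$ does not depend on their choice.) Then for all $f\in L^2(\mathbb R)$, $$\operatorname{supp}\widehat f\subset h^{-1}\cdot Y+[-2^k,2^k]\quad\Longrightarrow\quad \|f\|_{L^2(U'_k)}\ge c\,\|f\|_{L^2(\mathbb R)}.$$ -/

import Mathlib

open scoped FourierTransform Pointwise Topology

/-- `I` is an interval of the real line (open, closed or half-open) of length `s`. -/
def IsIntervalOfLength (I : Set ℝ) (s : ℝ) : Prop :=
  I.OrdConnected ∧ MeasureTheory.volume I = ENNReal.ofReal s

/-- The closed set `Ω ⊆ ℝ` is `ν`-porous on scales `α₀` to `α₁`: every interval `I` whose length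
lies in `[α₀, α₁]` has a subinterval `J` of length `ν |I|` which does not meet `Ω`. -/
structure IsPorous (ν α₀ α₁ : ℝ) (Ω : Set ℝ) : Prop where
  isClosed : IsClosed Ω
  scale_pos : 0 < α₀
  scale_le : α₀ ≤ α₁
  nu_pos : 0 < ν
  nu_lt_one : ν < 1
  hole : ∀ (I : Set ℝ) (s : ℝ), IsIntervalOfLength I s → α₀ ≤ s → s ≤ α₁ →
    ∃ J : Set ℝ, J ⊆ I ∧ IsIntervalOfLength J (ν * s) ∧ Disjoint J Ω

/-- The dyadic interval `[2⁻ᵏ j, 2⁻ᵏ (j + 1)]`. -/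
noncomputable def dyadicInterval (k : ℕ) (j : ℤ) : Set ℝ :=
  Set.Icc (((2 : ℝ) ^ k)⁻¹ * (j : ℝ)) (((2 : ℝ) ^ k)⁻¹ * ((j : ℝ) + 1))

/-- `I'` is a choice of holes of `X` at scale `2⁻ᵏ`: for each dyadic interval `I` of length
`2⁻ᵏ`, a subinterval of `I` of length `ν |I|` which does not meet `X`. -/
def IsHoleFamily (ν : ℝ) (X : Set ℝ) (k : ℕ) (I' : ℤ → Set ℝ) : Prop :=
  ∀ j : ℤ, I' j ⊆ dyadicInterval k j ∧
    IsIntervalOfLength (I' j) (ν * ((2 : ℝ) ^ k)⁻¹) ∧ Disjoint (I' j) X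

/-- The (essential) support of a function that is defined up to null sets: the points that have
no neighbourhood on which `u = 0` almost everywhere. -/
def essSupp (u : ℝ → ℂ) : Set ℝ :=
  {ξ | ∀ V ∈ 𝓝 ξ, ¬ u =ᵐ[MeasureTheory.volume.restrict V] 0}

/-- The Fourier transform on `L²(ℝ)` in the normalization `f̂(ξ) = ∫ exp(-i x ξ) f(x) dx`.
Mathlib's `𝓕` uses `exp(-2 π i x ξ)`, so the frequency is divided by `2 π`. -/
noncomputable def fourierHat (f : MeasureTheory.Lp ℂ 2 (MeasureTheory.volume : MeasureTheory.Measure ℝ)) :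
    ℝ → ℂ :=
  fun ξ => (𝓕 f : MeasureTheory.Lp ℂ 2 (MeasureTheory.volume : MeasureTheory.Measure ℝ))
    (ξ / (2 * Real.pi))

open MeasureTheory Set Filter Complex
open scoped ENNReal NNReal ContDiff

/-! Rescale by `2 ^ k`, so that the holes of `X` contain intervals of radius `a = ν / 2` around
points `x j` in `[j, j + 1]`. Let `F` be the rescaled function, `φ` its spectral density, `T` the
integral of `|F|²` over the line and `G` its integral over the union of those intervals. Porosity of
`Y` makes `φ` vanish on an interval of length comparable to `2 ^ m` in every dyadic interval of
length `2 ^ m ≥ 2 ^ m₀`. The goal is `T ≤ D G` with `D` depending on `ν` only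
(`exists_lintegral_wave_le`).

The argument runs through the Cauchy transforms `C_j(z) = ∫ φ(ξ) exp(i x_j ξ) / (ξ - z) dξ`. Below
the real axis `C_j` is the Laplace transform of `F(x_j + t)`, `t > 0`, so by Plancherel its squared
norm on `Im z = -y` is `2π ∫ |F(x_j + t)|² exp(-2 y t) dt`. Summed over `j` this is at least `2π
exp(-4 y) T`, because every point has a centre at distance at most 2 on its left. It is at most `2π
G` plus a multiple of `exp(-2 a y) (2 + 1 / (2 y)) T`, because points outside the intervals are at
distance at least `a` from all centres. The upper bound also holds above the axis, by reflection.

Smallness in gaps (`tsum_lintegral_gap_le`): over a spectral gap `C_j` is holomorphic across the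
axis. A weighted mean value over a circle of radius `r` converts the decay in `|y|` into a factor
`exp(-a r)` in front of `T`, at the cost of a multiple of `G`.

Propagation (`enorm_sq_cauchyWave_le_of_gaps`): given `ξ₀`, take a gap near it at each of `M` dyadic
scales, and multiply `C_j` by `exp(c g)`, where each scale contributes to `Re g` at least 4 at a
fixed depth below `ξ₀`, but at most 3 on `Im z = -1` away from its own gap. Inside a gap of size `r`
the multiplier is large, but the factor `exp(-a r)` absorbs this for small `c`. Poisson majorization
then bounds the summed squared norms at the fixed depth by `exp(-2 c M) A T + B G`, with `A`
independent of `M`. They are also at least `κ T`, so a large `M` allows the `T` term to be absorbed.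
-/

/-! ### Fourier transform and Plancherel on `L¹ ∩ L²`. -/

/-- Both sides are locally integrable and define the same tempered distribution: pairing with a test
function moves the transform onto the test function, by definition on the left and by Fubini on the
right. -/
theorem toLp_fourier_ae_eq_integral {u : ℝ → ℂ} (h1 : Integrable u) (h2 : MemLp u 2) :
    (𝓕 (h2.toLp u) : Lp ℂ 2 (volume : Measure ℝ)) =ᵐ[volume] 𝓕 u := by
  have hc : Continuous (𝓕 u) := by
    exact VectorFourier.fourierIntegral_continuous Real.continuous_fourierChar (by fun_prop) h1
  refine ae_eq_of_integral_contDiff_smul_eq ?_ hc.locallyIntegrable ?_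
  · exact (Lp.memLp _).locallyIntegrable (by norm_num)
  intro g hg hgc
  set G : ℝ → ℂ := fun x => (g x : ℂ) with hG
  have hGs : ContDiff ℝ ∞ G := Complex.ofRealCLM.contDiff.comp hg
  have hGc : HasCompactSupport G := hgc.comp_left (g := fun x : ℝ => (x : ℂ)) (by simp)
  set S := hGc.toSchwartzMap hGs with hS
  have hSG : ∀ x, S x = G x := fun x => rfl
  have e1 := congrArg (fun T => T S) (Lp.fourier_toTemperedDistribution_eq (h2.toLp u))
  simp only [TemperedDistribution.fourier_apply, Lp.toTemperedDistribution_apply] at e1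
  have e2 : ∀ x, g x • (𝓕 (h2.toLp u) : Lp ℂ 2 (volume : Measure ℝ)) x
      = S x • (𝓕 (h2.toLp u) : Lp ℂ 2 (volume : Measure ℝ)) x := by
    intro x; rw [hSG]; simp [hG]
  simp_rw [e2]
  rw [← e1]
  have e3 : ∫ x, (𝓕 S) x • (h2.toLp u) x = ∫ x, (𝓕 S) x • u x := by
    apply integral_congr_ae
    filter_upwards [h2.coeFn_toLp] with x hx
    rw [hx]
  rw [e3]
  have := VectorFourier.integral_fourierIntegral_smul_eq_flip (μ := volume) (ν := volume)
    (L := innerₗ ℝ) (f := G) (g := u) Real.continuous_fourierChar (by fun_prop)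
    (S.integrable (μ := volume)) h1
  rw [flip_innerₗ] at this
  rw [SchwartzMap.fourier_coe]
  have e4 : ∀ x, g x • 𝓕 u x = G x • 𝓕 u x := by intro x; simp [hG]
  simp_rw [e4]
  exact this

theorem toLp_fourierInv_ae_eq_integral {u : ℝ → ℂ} (h1 : Integrable u) (h2 : MemLp u 2) :
    (𝓕⁻ (h2.toLp u) : Lp ℂ 2 (volume : Measure ℝ)) =ᵐ[volume] 𝓕⁻ u := by
  have hc0 : Continuous (𝓕 u) := by
    exact VectorFourier.fourierIntegral_continuous Real.continuous_fourierChar (by fun_prop) h1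
  have hc : Continuous (𝓕⁻ u) := by
    have : 𝓕⁻ u = fun x => 𝓕 u (-x) := by ext x; exact Real.fourierInv_eq_fourier_neg u x
    rw [this]; fun_prop
  refine ae_eq_of_integral_contDiff_smul_eq ?_ hc.locallyIntegrable ?_
  · exact (Lp.memLp _).locallyIntegrable (by norm_num)
  intro g hg hgc
  set G : ℝ → ℂ := fun x => (g x : ℂ) with hG
  have hGs : ContDiff ℝ ∞ G := Complex.ofRealCLM.contDiff.comp hg
  have hGc : HasCompactSupport G := hgc.comp_left (g := fun x : ℝ => (x : ℂ)) (by simp)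
  set S := hGc.toSchwartzMap hGs with hS
  have hSG : ∀ x, S x = G x := fun x => rfl
  have e1 := congrArg (fun T => T S) (Lp.fourierInv_toTemperedDistribution_eq (h2.toLp u))
  simp only [TemperedDistribution.fourierInv_apply, Lp.toTemperedDistribution_apply] at e1
  have e2 : ∀ x, g x • (𝓕⁻ (h2.toLp u) : Lp ℂ 2 (volume : Measure ℝ)) x
      = S x • (𝓕⁻ (h2.toLp u) : Lp ℂ 2 (volume : Measure ℝ)) x := by
    intro x; rw [hSG]; simp [hG]
  simp_rw [e2]
  rw [← e1]
  have e3 : ∫ x, (𝓕⁻ S) x • (h2.toLp u) x = ∫ x, (𝓕⁻ S) x • u x := by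
    apply integral_congr_ae
    filter_upwards [h2.coeFn_toLp] with x hx
    rw [hx]
  rw [e3]
  have := VectorFourier.integral_fourierIntegral_smul_eq_flip (μ := volume) (ν := volume)
    (L := innerₗ ℝ) (f := fun x => G (-x)) (g := u) Real.continuous_fourierChar (by fun_prop)
    (S.integrable (μ := volume)).comp_neg h1
  rw [flip_innerₗ] at this
  rw [SchwartzMap.fourierInv_coe, Real.fourierInv_eq_fourier_comp_neg]
  have e4 : ∀ x, g x • 𝓕⁻ u x = G (- -x) • 𝓕 u (-x) := by
    intro x; rw [Real.fourierInv_eq_fourier_neg]; simp [hG]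
  simp_rw [e4]
  rw [integral_neg_eq_self (fun x => G (-x) • 𝓕 u x)]
  exact this

theorem lintegral_enorm_sq_eq_eLpNorm_sq (u : ℝ → ℂ) (μ : Measure ℝ) :
    ∫⁻ x, ‖u x‖ₑ ^ 2 ∂μ = eLpNorm u 2 μ ^ 2 := by
  rw [eLpNorm_eq_lintegral_rpow_enorm_toReal (by norm_num) (by norm_num)]
  simp only [ENNReal.toReal_ofNat, one_div]
  rw [← ENNReal.rpow_natCast (n := 2), ← ENNReal.rpow_mul]
  norm_num

/-- Plancherel's identity for functions in `L¹ ∩ L²`. -/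
theorem lintegral_enorm_sq_fourier {u : ℝ → ℂ} (h1 : Integrable u) (h2 : MemLp u 2) :
    ∫⁻ ξ, ‖𝓕 u ξ‖ₑ ^ 2 = ∫⁻ x, ‖u x‖ₑ ^ 2 := by
  rw [lintegral_enorm_sq_eq_eLpNorm_sq, lintegral_enorm_sq_eq_eLpNorm_sq,
    ← eLpNorm_congr_ae (toLp_fourier_ae_eq_integral h1 h2), ← eLpNorm_congr_ae h2.coeFn_toLp,
    ← Lp.enorm_def, ← Lp.enorm_def]
  congr 1
  rw [← ofReal_norm, ← ofReal_norm, Lp.norm_fourier_eq]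

/-! ### Poisson majorization below the line `Im z = -1`. -/

/-- Cauchy's theorem on the rectangle with corners `±R - i` and `±R - (1 + R) i`: the other three
sides have total length `4 R`, and the integrand there is at most `C / R ^ 2`. -/
theorem integral_line_eq_zero_of_decay {Q : ℂ → ℂ} (hd : DifferentiableOn ℂ Q {z | z.im ≤ -1})
    {C R₀ : ℝ} (hC : ∀ z : ℂ, z.im ≤ -1 → R₀ ≤ ‖z‖ → ‖Q z‖ ≤ C / ‖z‖ ^ 2)
    (hi : Integrable fun ξ : ℝ => Q (ξ - I)) : ∫ ξ : ℝ, Q (ξ - I) = 0 := by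
  have h1 : Tendsto (fun R : ℝ => ∫ x in (-R)..R, Q (x - I)) atTop (𝓝 (∫ ξ : ℝ, Q (ξ - I))) :=
    intervalIntegral_tendsto_integral hi tendsto_neg_atTop_atBot tendsto_id
  refine tendsto_nhds_unique h1 ?_
  have key : ∀ R : ℝ, 1 ≤ R → R₀ ≤ R → ‖∫ x in (-R)..R, Q (x - I)‖ ≤ (4 * C) * R⁻¹ := by
    intro R hR hR0
    have hrect := Complex.integral_boundary_rect_eq_zero_of_differentiableOn Q
      (⟨-R, -1⟩ : ℂ) (⟨R, -1 - R⟩ : ℂ) (hd.mono ?_)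
    swap
    · intro z hz
      rw [mem_reProdIm] at hz
      have := hz.2
      rw [uIcc_comm, uIcc_of_le (by simp; linarith)] at this
      exact this.2
    have hb : ∀ z : ℂ, z.im ≤ -1 → R ≤ ‖z‖ → ‖Q z‖ ≤ C / R ^ 2 := by
      intro z hz hzR
      have hC0 : 0 ≤ C := by
        have := (norm_nonneg _).trans (hC z hz (hR0.trans hzR))
        by_contra hneg
        push Not at hneg
        have hzp : 0 < ‖z‖ := by linarith
        have : C / ‖z‖ ^ 2 < 0 := div_neg_of_neg_of_pos hneg (by positivity)
        linarith
      refine (hC z hz (hR0.trans hzR)).trans ?_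
      have hRp : 0 < R := by linarith
      gcongr
    have b1 : ‖∫ x : ℝ in (-R)..R, Q (x + ((-1 - R : ℝ) : ℂ) * I)‖ ≤ C / R ^ 2 * |R - -R| := by
      refine intervalIntegral.norm_integral_le_of_norm_le_const fun x _ => hb _ ?_ ?_
      · simp; linarith
      · refine le_trans ?_ (abs_im_le_norm _)
        simp [abs_of_nonpos (show -1 - R ≤ 0 by linarith)]
    have b2 : ‖∫ y : ℝ in (-1)..(-1 - R), Q ((R : ℂ) + y * I)‖ ≤ C / R ^ 2 * |(-1 - R) - (-1)| := by
      refine intervalIntegral.norm_integral_le_of_norm_le_const fun x hx => hb _ ?_ ?_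
      · rw [uIoc_comm, uIoc_of_le (by linarith)] at hx
        simpa using hx.2
      · refine le_trans ?_ (abs_re_le_norm _)
        simp [le_abs_self]
    have b3 : ‖∫ y : ℝ in (-1)..(-1 - R), Q (((-R : ℝ) : ℂ) + y * I)‖ ≤
        C / R ^ 2 * |(-1 - R) - (-1)| := by
      refine intervalIntegral.norm_integral_le_of_norm_le_const fun x hx => hb _ ?_ ?_
      · rw [uIoc_comm, uIoc_of_le (by linarith)] at hx
        simpa using hx.2
      · refine le_trans ?_ (abs_re_le_norm _)
        simp [le_abs_self]
    have e0 : ∫ x in (-R)..R, Q (x - I) = ∫ x : ℝ in (-R)..R, Q (x + ((-1 : ℝ) : ℂ) * I) := by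
      congr 1; ext x; congr 1; simp [sub_eq_add_neg]
    simp only [smul_eq_mul] at hrect
    have e1 : ∫ x in (-R)..R, Q (x - I) = (∫ x : ℝ in (-R)..R, Q (x + ((-1 - R : ℝ) : ℂ) * I))
        - I * (∫ y : ℝ in (-1)..(-1 - R), Q ((R : ℂ) + y * I))
        + I * (∫ y : ℝ in (-1)..(-1 - R), Q (((-R : ℝ) : ℂ) + y * I)) := by
      rw [e0]; linear_combination hrect
    rw [e1]
    have a1 : |R - -R| = 2 * R := by rw [abs_of_nonneg] <;> linarith
    have a2 : |(-1 - R) - (-1)| = R := by rw [abs_of_nonpos] <;> linarith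
    rw [a1] at b1
    rw [a2] at b2 b3
    refine (norm_add_le _ _).trans ((add_le_add_left (norm_sub_le _ _) _).trans ?_)
    rw [norm_mul, norm_mul, norm_I, one_mul, one_mul]
    have : C / R ^ 2 * (2 * R) + C / R ^ 2 * R + C / R ^ 2 * R = 4 * C * R⁻¹ := by
      field_simp; ring
    linarith
  refine squeeze_zero_norm' ?_ (by simpa using tendsto_inv_atTop_zero.const_mul (4 * C))
  filter_upwards [eventually_ge_atTop 1, eventually_ge_atTop R₀] with R h1 h2 using key R h1 h2

theorem integrable_poisson (x₀ : ℝ) {y : ℝ} (hy : 0 < y) :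
    Integrable fun x : ℝ => ((x - x₀) ^ 2 + y ^ 2)⁻¹ := by
  have h := ((integrable_inv_one_add_sq.comp_div (R := y) hy.ne').comp_sub_right x₀).const_mul
    ((y ^ 2)⁻¹)
  refine h.congr (Eventually.of_forall fun x => ?_)
  simp only
  rw [← mul_inv]
  congr 1
  field_simp
  ring

theorem integral_poisson (x₀ : ℝ) {y : ℝ} (hy : 0 < y) :
    ∫ x : ℝ, ((x - x₀) ^ 2 + y ^ 2)⁻¹ = Real.pi / y := by
  have h : ∀ x : ℝ, ((x - x₀) ^ 2 + y ^ 2)⁻¹ =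
      (fun x => (y ^ 2)⁻¹ * (1 + (x / y) ^ 2)⁻¹) (x - x₀) := by
    intro x
    simp only
    rw [← mul_inv]
    congr 1
    field_simp
    ring
  simp_rw [h]
  rw [integral_sub_right_eq_self (fun x : ℝ => (y ^ 2)⁻¹ * (1 + (x / y) ^ 2)⁻¹) x₀,
    integral_const_mul, Measure.integral_comp_div (fun x : ℝ => (1 + x ^ 2)⁻¹) y,
    integral_univ_inv_one_add_sq, abs_of_pos hy, smul_eq_mul]
  field_simp

/-- The Poisson majorization in a half-plane. -/
theorem enorm_le_lintegral_poisson {H : ℂ → ℂ} (hd : DifferentiableOn ℂ H {z | z.im < 0})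
    {B : ℝ} (hB : ∀ z : ℂ, z.im ≤ -1 → ‖H z‖ ≤ B) (x₀ : ℝ) {y : ℝ} (hy : 0 < y) :
    ‖H (x₀ - (1 + y) * I)‖ₑ ≤
      ∫⁻ x : ℝ, ‖H (x - I)‖ₑ * ENNReal.ofReal (y / Real.pi * ((x - x₀) ^ 2 + y ^ 2)⁻¹) := by
  set z₀ : ℂ := x₀ - (1 + y) * I with hz₀
  -- `z₁` is the mirror image of `z₀` in the line `Im z = -1`, so `(z - z₀) (z - z₁)` restricts to
  -- the Poisson denominator on that line.
  set z₁ : ℂ := x₀ - (1 - y) * I with hz₁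
  have him0 : z₀.im = -1 - y := by simp [hz₀]; ring
  have him1 : z₁.im = -1 + y := by simp [hz₁]; ring
  have hB0 : 0 ≤ B := (norm_nonneg _).trans (hB (-I) (by simp))
  have hopen : IsOpen {z : ℂ | z.im < 0} := isOpen_lt Complex.continuous_im continuous_const
  have hds : DifferentiableOn ℂ (dslope H z₀) {z | z.im < 0} :=
    (Complex.differentiableOn_dslope (hopen.mem_nhds (by simp [him0]; linarith))).2 hd
  have hsub : {z : ℂ | z.im ≤ -1} ⊆ {z : ℂ | z.im < 0} := fun z hz => by
    have hz' : z.im ≤ -1 := hz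
    change z.im < 0
    linarith
  have hprod : ∀ x : ℝ, ((x : ℂ) - I - z₀) * ((x : ℂ) - I - z₁) = (((x - x₀) ^ 2 + y ^ 2 : ℝ) : ℂ) := by
    intro x
    simp only [hz₀, hz₁]
    push_cast
    linear_combination (-(y : ℂ) ^ 2) * I_sq
  have hline : ∀ x : ℝ, dslope H z₀ (x - I) * (x - I - z₁)⁻¹ =
      (H (x - I) - H z₀) * ((((x - x₀) ^ 2 + y ^ 2)⁻¹ : ℝ) : ℂ) := by
    intro x
    have hne : (x : ℂ) - I ≠ z₀ := by
      intro h
      have := congrArg Complex.im h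
      rw [him0] at this; simp at this; linarith
    rw [dslope_of_ne _ hne, slope_def_field, ofReal_inv, ← hprod, mul_inv]
    ring
  have hcont : Continuous fun x : ℝ => H (x - I) := by
    refine ContinuousOn.comp_continuous (s := {z | z.im < 0}) hd.continuousOn (by fun_prop) ?_
    intro x; simp
  have hP := integrable_poisson x₀ hy
  have hHP : Integrable fun x : ℝ => H (x - I) * ((((x - x₀) ^ 2 + y ^ 2)⁻¹ : ℝ) : ℂ) := by
    refine hP.ofReal.bdd_mul (c := B) hcont.aestronglyMeasurable ?_
    exact Eventually.of_forall fun x => hB _ (by simp)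
  have hcP : Integrable fun x : ℝ => H z₀ * ((((x - x₀) ^ 2 + y ^ 2)⁻¹ : ℝ) : ℂ) :=
    hP.ofReal.const_mul _
  -- The divided difference `dslope H z₀` removes the pole at `z₀`, and `z₁` lies above the line, so
  -- no residue appears: `H - H z₀` integrates to zero against the Poisson kernel.
  have hz := integral_line_eq_zero_of_decay (Q := fun z => dslope H z₀ z * (z - z₁)⁻¹)
    (C := 8 * B) (R₀ := 2 * (‖z₀‖ + ‖z₁‖) + 1) ?_ ?_ ?_
  · simp only [hline, sub_mul] at hz
    rw [integral_sub hHP hcP, integral_const_mul, integral_complex_ofReal, integral_poisson x₀ hy] at hz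
    have hval : H z₀ = ∫ x : ℝ, H (x - I) * ((y / Real.pi * ((x - x₀) ^ 2 + y ^ 2)⁻¹ : ℝ) : ℂ) := by
      have : ∀ x : ℝ, H (x - I) * ((y / Real.pi * ((x - x₀) ^ 2 + y ^ 2)⁻¹ : ℝ) : ℂ) =
          ((y / Real.pi : ℝ) : ℂ) * (H (x - I) * ((((x - x₀) ^ 2 + y ^ 2)⁻¹ : ℝ) : ℂ)) := by
        intro x; push_cast; ring
      simp_rw [this]
      rw [integral_const_mul, sub_eq_zero.1 hz]
      have hpi : (Real.pi : ℂ) ≠ 0 := by exact_mod_cast Real.pi_ne_zero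
      have hyc : (y : ℂ) ≠ 0 := by exact_mod_cast hy.ne'
      push_cast
      field_simp
    rw [hval]
    refine (enorm_integral_le_lintegral_enorm _).trans (lintegral_mono fun x => ?_)
    rw [enorm_mul]
    gcongr
    rw [← ofReal_norm, Complex.norm_real, Real.norm_of_nonneg (by have := Real.pi_pos; positivity)]
  · refine (hds.mono hsub).mul (DifferentiableOn.inv (by fun_prop) ?_)
    intro z hz h
    have := congrArg Complex.im (sub_eq_zero.1 h)
    rw [him1] at this
    have hz' : z.im ≤ -1 := hz
    linarith
  · intro z hz hR
    have n0 := norm_nonneg z₀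
    have n1 := norm_nonneg z₁
    have h0 : ‖z‖ / 2 ≤ ‖z - z₀‖ := by
      have := norm_sub_norm_le z z₀; linarith
    have h1 : ‖z‖ / 2 ≤ ‖z - z₁‖ := by
      have := norm_sub_norm_le z z₁; linarith
    have hzp : 0 < ‖z‖ := by linarith
    have hne : z ≠ z₀ := by
      intro h; rw [h] at hR; linarith
    rw [dslope_of_ne _ hne, slope_def_field, norm_mul, norm_div, norm_inv]
    have h2 : ‖H z - H z₀‖ ≤ 2 * B := by
      refine (norm_sub_le _ _).trans ?_
      have := hB z hz
      have := hB z₀ (by rw [him0]; linarith)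
      linarith
    calc ‖H z - H z₀‖ / ‖z - z₀‖ * ‖z - z₁‖⁻¹ ≤ (2 * B) / (‖z‖ / 2) * (‖z‖ / 2)⁻¹ := by gcongr
      _ = 8 * B / ‖z‖ ^ 2 := by field_simp; ring
  · simp only [hline, sub_mul]
    exact hHP.sub hcP

/-! ### Cauchy transforms and their `L²` norms on horizontal lines. -/

/-- The inverse Fourier integral `∫ φ(ξ) exp(i x ξ) dξ` without normalizing factor. -/
noncomputable def waveIntegral (φ : ℝ → ℂ) (x : ℝ) : ℂ := ∫ ξ : ℝ, φ ξ * exp (x * ξ * I)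

/-- The Cauchy transform of `φ(ξ) exp(i x ξ)`. -/
noncomputable def cauchyWave (φ : ℝ → ℂ) (x : ℝ) (z : ℂ) : ℂ :=
  ∫ ξ : ℝ, φ ξ * exp (x * ξ * I) / (ξ - z)

theorem norm_exp_wave (x ξ : ℝ) : ‖exp (x * ξ * I)‖ = 1 := by
  have := Complex.norm_exp_ofReal_mul_I (x * ξ)
  push_cast at this
  exact this

theorem integrable_mul_wave {φ : ℝ → ℂ} (hφ : Integrable φ) (x : ℝ) :
    Integrable fun ξ : ℝ => φ ξ * exp (x * ξ * I) := by
  refine hφ.mul_bdd (c := 1) (by fun_prop) (Eventually.of_forall fun ξ => (norm_exp_wave x ξ).le)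

theorem norm_waveIntegral_le (φ : ℝ → ℂ) (x : ℝ) : ‖waveIntegral φ x‖ ≤ ∫ ξ, ‖φ ξ‖ := by
  refine (norm_integral_le_integral_norm _).trans (le_of_eq ?_)
  congr 1; ext ξ; rw [norm_mul, norm_exp_wave, mul_one]

theorem measurable_waveIntegral {φ : ℝ → ℂ} (hφ : Measurable φ) :
    Measurable (waveIntegral φ) := by
  have h : Measurable fun p : ℝ × ℝ => φ p.2 * exp (p.1 * p.2 * I) := by fun_prop
  exact (h.stronglyMeasurable.integral_prod_right (ν := volume)).measurable

theorem measurable_cauchyWave {φ : ℝ → ℂ} (hφ : Measurable φ) (x : ℝ) :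
    Measurable (cauchyWave φ x) := by
  have h : Measurable fun p : ℂ × ℝ => φ p.2 * exp (x * p.2 * I) / (p.2 - p.1) := by fun_prop
  exact (h.stronglyMeasurable.integral_prod_right (ν := volume)).measurable

theorem norm_cauchyWave_le {φ : ℝ → ℂ} (hφ : Integrable φ) (x : ℝ) {z : ℂ} (hz : z.im ≤ -1) :
    ‖cauchyWave φ x z‖ ≤ ∫ ξ, ‖φ ξ‖ := by
  refine (norm_integral_le_of_norm_le hφ.norm (Eventually.of_forall fun ξ => ?_))
  rw [norm_div, norm_mul, norm_exp_wave, mul_one]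
  refine div_le_self (norm_nonneg _) ?_
  have := abs_im_le_norm ((ξ : ℂ) - z)
  simp only [sub_im, ofReal_im, zero_sub, abs_neg] at this
  rw [abs_of_nonpos (by linarith)] at this
  linarith

/-- Only the distance from `z` to the support of `u` matters, so this applies at real `z` inside a
gap as well as off the axis. -/
theorem hasDerivAt_cauchy {u : ℝ → ℂ} (hu : Integrable u) {z : ℂ} {δ : ℝ} (hδ : 0 < δ)
    (h : ∀ ξ : ℝ, u ξ ≠ 0 → δ ≤ ‖(ξ : ℂ) - z‖) :
    DifferentiableAt ℂ (fun z : ℂ => ∫ ξ : ℝ, u ξ / (ξ - z)) z := by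
  have hb : ∀ ξ : ℝ, u ξ ≠ 0 → ∀ w ∈ Metric.ball z (δ / 2), δ / 2 ≤ ‖(ξ : ℂ) - w‖ := by
    intro ξ hξ w hw
    have h1 := h ξ hξ
    rw [Metric.mem_ball, dist_eq_norm] at hw
    have := norm_add_le ((ξ : ℂ) - w) (w - z)
    rw [sub_add_sub_cancel] at this
    linarith
  have hm : ∀ w : ℂ, AEStronglyMeasurable (fun ξ : ℝ => u ξ / (ξ - w)) volume := fun w =>
    (hu.aestronglyMeasurable.aemeasurable.div
      (by fun_prop : Measurable fun ξ : ℝ => (ξ : ℂ) - w).aemeasurable).aestronglyMeasurable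
  refine (hasDerivAt_integral_of_dominated_loc_of_deriv_le (μ := volume)
    (F := fun (z : ℂ) (ξ : ℝ) => u ξ / (ξ - z))
    (F' := fun (z : ℂ) (ξ : ℝ) => u ξ / (ξ - z) ^ 2) (bound := fun ξ => ‖u ξ‖ / (δ / 2) ^ 2)
    (Metric.ball_mem_nhds z (half_pos hδ)) (Eventually.of_forall hm) ?_ ?_ ?_
    (hu.norm.div_const _) ?_).2.differentiableAt
  · refine (hu.norm.div_const δ).mono' (hm z) (Eventually.of_forall fun ξ => ?_)
    rw [norm_div]
    by_cases h0 : u ξ = 0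
    · simp [h0]
    · have := h ξ h0
      gcongr
  · exact (hu.aestronglyMeasurable.aemeasurable.div
      (by fun_prop : Measurable fun ξ : ℝ => ((ξ : ℂ) - z) ^ 2).aemeasurable).aestronglyMeasurable
  · refine Eventually.of_forall fun ξ w hw => ?_
    rw [norm_div, norm_pow]
    by_cases h0 : u ξ = 0
    · simp [h0]
    · have := hb ξ h0 w hw
      gcongr
  · refine Eventually.of_forall fun ξ w hw => ?_
    by_cases h0 : u ξ = 0
    · simpa [h0] using hasDerivAt_const w (0 : ℂ)
    · have h1 := hb ξ h0 w hw
      have hne : (ξ : ℂ) - w ≠ 0 := norm_pos_iff.1 (by linarith)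
      have h2 := ((hasDerivAt_const w (u ξ)).div ((hasDerivAt_id w).const_sub (ξ : ℂ)) hne)
      exact h2.congr_deriv (by simp)

theorem differentiableAt_cauchyWave {φ : ℝ → ℂ} (hφ : Integrable φ) (x : ℝ) {z : ℂ} {δ : ℝ}
    (hδ : 0 < δ) (h : ∀ ξ : ℝ, φ ξ ≠ 0 → δ ≤ ‖(ξ : ℂ) - z‖) :
    DifferentiableAt ℂ (cauchyWave φ x) z :=
  hasDerivAt_cauchy (integrable_mul_wave hφ x) hδ fun ξ hξ => h ξ (left_ne_zero_of_mul hξ)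

theorem differentiableOn_cauchyWave {φ : ℝ → ℂ} (hφ : Integrable φ) (x : ℝ) :
    DifferentiableOn ℂ (cauchyWave φ x) {z | z.im < 0} := by
  intro z hz
  have hz' : z.im < 0 := hz
  refine (differentiableAt_cauchyWave hφ x (δ := -z.im) (by linarith)
    fun ξ _ => ?_).differentiableWithinAt
  have h2 := abs_im_le_norm ((ξ : ℂ) - z)
  rw [sub_im, ofReal_im, zero_sub, abs_neg] at h2
  exact (neg_le_abs _).trans h2

/-- The Cauchy transform in the lower half-plane is a one-sided Laplace transform. -/
theorem cauchyWave_eq_integral_Ioi {φ : ℝ → ℂ} (hφ : Integrable φ) (x : ℝ) {y : ℝ} (hy : 0 < y)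
    (ξ : ℝ) :
    cauchyWave φ x (ξ - y * I) =
      -I * ∫ t in Ioi (0 : ℝ), waveIntegral φ (x + t) * exp (-(y * t)) * exp (-(t * ξ * I)) := by
  have hint : Integrable (Function.uncurry fun (t η : ℝ) =>
      φ η * exp (x * η * I) * exp ((((η : ℂ) - ξ) * I - y) * t))
      ((volume.restrict (Ioi 0)).prod volume) := by
    have h1 : Integrable (fun p : ℝ × ℝ => exp ((-y : ℂ) * p.1) * (φ p.2 * exp (x * p.2 * I)))
        ((volume.restrict (Ioi 0)).prod volume) :=
      Integrable.mul_prod (integrableOn_exp_mul_complex_Ioi (by simpa using hy) 0)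
        (integrable_mul_wave hφ x)
    have h2 := h1.mul_bdd (c := 1) (g := fun p : ℝ × ℝ => exp ((p.1 * (p.2 - ξ) : ℝ) * I))
      (by fun_prop) (Eventually.of_forall fun p => (Complex.norm_exp_ofReal_mul_I _).le)
    refine h2.congr (Eventually.of_forall fun p => ?_)
    simp only [Function.uncurry]
    rw [show (((p.2 : ℂ) - ξ) * I - y) * p.1 = -y * p.1 + ((p.1 * (p.2 - ξ) : ℝ)) * I by
      push_cast; ring, exp_add]
    ring
  have hL : ∀ t : ℝ, waveIntegral φ (x + t) * exp (-(y * t)) * exp (-(t * ξ * I)) =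
      ∫ η : ℝ, φ η * exp (x * η * I) * exp ((((η : ℂ) - ξ) * I - y) * t) := by
    intro t
    rw [waveIntegral, mul_assoc, ← integral_mul_const]
    congr 1; ext η
    have : exp ((x + t : ℝ) * η * I) * (exp (-(y * t)) * exp (-(t * ξ * I))) =
        exp (x * η * I) * exp ((((η : ℂ) - ξ) * I - y) * t) := by
      rw [← exp_add, ← exp_add, ← exp_add]
      congr 1
      push_cast; ring
    rw [mul_assoc (φ η), this, mul_assoc (φ η)]
  simp_rw [hL]
  rw [integral_integral_swap hint, cauchyWave, ← integral_const_mul]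
  congr 1; ext η
  rw [integral_const_mul, integral_exp_mul_complex_Ioi (by simpa using hy)]
  have hI : ((η : ℂ) - ξ) * I - y = I * (η - (ξ - y * I)) := by linear_combination (-(y : ℂ)) * I_sq
  have hne2 : (η : ℂ) - (ξ - y * I) ≠ 0 := by
    intro h
    have := congrArg Complex.im h
    simp at this
    exact hy.ne' this
  rw [ofReal_zero, mul_zero, exp_zero, hI]
  have hI0 : I ≠ 0 := I_ne_zero
  field_simp

theorem lintegral_comp_div {g : ℝ → ℝ≥0∞} (hg : Measurable g) {a : ℝ} (ha : 0 < a) :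
    ∫⁻ x, g (x / a) = ENNReal.ofReal a * ∫⁻ x, g x := by
  have h := lintegral_map (μ := volume) hg (measurable_id.mul_const a⁻¹)
  rw [show (fun x => id x * a⁻¹) = (· * a⁻¹) from rfl, Real.map_volume_mul_right (by positivity),
    lintegral_smul_measure, inv_inv, abs_of_pos ha, smul_eq_mul] at h
  rw [h]; rfl

/-- Plancherel for the truncated, exponentially damped function `v`, whose transform is the
restriction of the Cauchy transform to the line, up to a unimodular factor and the scaling by `2π`.
-/
theorem lintegral_cauchyWave_lower {φ : ℝ → ℂ} (hm : Measurable φ) (hφ : Integrable φ) (x : ℝ)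
    {y : ℝ} (hy : 0 < y) :
    ∫⁻ ξ : ℝ, ‖cauchyWave φ x (ξ - y * I)‖ₑ ^ 2 =
      ENNReal.ofReal (2 * Real.pi) *
        ∫⁻ t in Ioi (0 : ℝ), ‖waveIntegral φ (x + t)‖ₑ ^ 2 * ENNReal.ofReal (Real.exp (-(2 * y * t))) := by
  set v : ℝ → ℂ := (Ioi (0 : ℝ)).indicator fun t => waveIntegral φ (x + t) * exp (-(y * t)) with hv
  have hvm : Measurable v := by
    refine Measurable.indicator ?_ measurableSet_Ioi
    have := (measurable_waveIntegral hm).comp (measurable_const_add x)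
    exact this.mul (by fun_prop)
  have he : IntegrableOn (fun t : ℝ => exp (-(y * t))) (Ioi 0) := by
    have := integrableOn_exp_mul_complex_Ioi (a := -(y : ℂ)) (by simpa using hy) 0
    simpa only [neg_mul] using this
  have hv1 : Integrable v := by
    rw [hv, integrable_indicator_iff measurableSet_Ioi]
    refine Integrable.bdd_mul (c := ∫ ξ, ‖φ ξ‖) he ?_
      (Eventually.of_forall fun t => norm_waveIntegral_le φ _)
    exact ((measurable_waveIntegral hm).comp (measurable_const_add x)).aestronglyMeasurable
  have hvb : ∀ t, ‖v t‖ ≤ ∫ ξ, ‖φ ξ‖ := by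
    intro t
    rw [hv]
    by_cases ht : t ∈ Ioi (0 : ℝ)
    · rw [indicator_of_mem ht, norm_mul, ← mul_one (∫ ξ, ‖φ ξ‖)]
      have ht' : 0 < t := ht
      have hyt : 0 < y * t := by positivity
      refine mul_le_mul (norm_waveIntegral_le φ _) ?_ (norm_nonneg _) (by positivity)
      rw [Complex.norm_exp]; simp; positivity
    · rw [indicator_of_notMem ht, norm_zero]; positivity
  have hv2 : MemLp v 2 := by
    rw [memLp_two_iff_integrable_sq_norm hvm.aestronglyMeasurable]
    simp_rw [pow_two]
    exact hv1.norm.bdd_mul (c := ∫ ξ, ‖φ ξ‖) hvm.norm.aestronglyMeasurable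
      (Eventually.of_forall fun t => by rw [norm_norm]; exact hvb t)
  have hF : ∀ ξ : ℝ, cauchyWave φ x (ξ - y * I) = -I * 𝓕 v (ξ / (2 * Real.pi)) := by
    intro ξ
    rw [cauchyWave_eq_integral_Ioi hφ x hy, Real.fourier_eq']
    congr 1
    rw [← integral_indicator measurableSet_Ioi]
    congr 1; ext t
    rw [hv]
    by_cases ht : t ∈ Ioi (0 : ℝ)
    · rw [indicator_of_mem ht, indicator_of_mem ht, smul_eq_mul, mul_comm]
      congr 2
      have hpi : (Real.pi : ℂ) ≠ 0 := by exact_mod_cast Real.pi_ne_zero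
      simp
      field_simp
    · rw [indicator_of_notMem ht, indicator_of_notMem ht, smul_zero]
  have hFc : Continuous (𝓕 v) :=
    VectorFourier.fourierIntegral_continuous Real.continuous_fourierChar (by fun_prop) hv1
  have hnI : ‖(-I : ℂ)‖ₑ = 1 := by rw [enorm_neg, ← ofReal_norm, norm_I, ENNReal.ofReal_one]
  simp_rw [hF, enorm_mul, hnI, one_mul]
  rw [lintegral_comp_div (g := fun ξ => ‖𝓕 v ξ‖ₑ ^ 2) (by fun_prop) (by positivity),
    lintegral_enorm_sq_fourier hv1 hv2, ← lintegral_indicator measurableSet_Ioi]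
  congr 2; ext t
  rw [hv]
  by_cases ht : t ∈ Ioi (0 : ℝ)
  · rw [indicator_of_mem ht, indicator_of_mem ht, enorm_mul, mul_pow]
    congr 1
    rw [← ofReal_norm (exp _), ← ENNReal.ofReal_pow (norm_nonneg _), Complex.norm_exp,
      ← Real.exp_nat_mul]
    congr 2
    simp; ring
  · rw [indicator_of_notMem ht, indicator_of_notMem ht, enorm_zero, zero_pow two_ne_zero]

/-! ### Summation over the centres. -/

/-- `x j` is the centre of an interval of radius `a` inside `[j, j + 1]`, for every integer `j`. -/
def IsCentreFamily (a : ℝ) (x : ℤ → ℝ) : Prop :=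
  ∀ j : ℤ, (j : ℝ) ≤ x j - a ∧ x j + a ≤ j + 1

/-- The union of the open intervals of radius `a` around the points `x j`. -/
def centreUnion (a : ℝ) (x : ℤ → ℝ) : Set ℝ := ⋃ j : ℤ, Ioo (x j - a) (x j + a)

theorem measurableSet_centreUnion (a : ℝ) (x : ℤ → ℝ) : MeasurableSet (centreUnion a x) :=
  MeasurableSet.iUnion fun _ => measurableSet_Ioo

/-- The one-sided exponential kernel `exp(-2 y t)` on `t > 0`. -/
noncomputable def expKernel (y t : ℝ) : ℝ≥0∞ :=
  (Ioi (0 : ℝ)).indicator (fun t => ENNReal.ofReal (Real.exp (-(2 * y * t)))) t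

theorem measurable_expKernel (y : ℝ) : Measurable (expKernel y) :=
  Measurable.indicator (by fun_prop) measurableSet_Ioi

theorem inv_one_sub_exp_le {y : ℝ} (hy : 0 < y) :
    (1 - Real.exp (-(2 * y)))⁻¹ ≤ 1 + 1 / (2 * y) := by
  have h1 : Real.exp (-(2 * y)) ≤ (1 + 2 * y)⁻¹ := by
    rw [Real.exp_neg]
    gcongr
    linarith [Real.add_one_le_exp (2 * y)]
  have h2 : 1 - (1 + 2 * y)⁻¹ = 2 * y / (1 + 2 * y) := by field_simp; ring
  have h3 : 0 < 2 * y / (1 + 2 * y) := by positivity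
  calc (1 - Real.exp (-(2 * y)))⁻¹ ≤ (2 * y / (1 + 2 * y))⁻¹ := by
        gcongr; linarith
    _ = 1 + 1 / (2 * y) := by field_simp; ring

/-- Only centres to the left of `s` count. With `n = ⌊s⌋`, the centre `x n` gives at most 1 if `s`
is within `a` of it and at most `exp(-2 a y)` otherwise. The centre `x (n - 1 - i)` is at distance
at least `a + i`, which gives a geometric series. -/
theorem tsum_expKernel_le {a : ℝ} (ha : 0 < a) {x : ℤ → ℝ} (hx : IsCentreFamily a x) {y : ℝ}
    (hy : 0 < y) (s : ℝ) :
    ∑' j : ℤ, expKernel y (s - x j) ≤ (centreUnion a x).indicator 1 s +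
      ENNReal.ofReal (Real.exp (-(2 * a * y)) * (2 + 1 / (2 * y))) := by
  set n : ℤ := ⌊s⌋ with hn
  have hn1 : (n : ℝ) ≤ s := Int.floor_le s
  have hn2 : s < n + 1 := Int.lt_floor_add_one s
  have hinj : Function.Injective (fun i : ℕ => n - (i : ℤ)) := fun i k h => by
    simpa using h
  have hsupp : Function.support (fun j : ℤ => expKernel y (s - x j)) ⊆
      range (fun i : ℕ => n - (i : ℤ)) := by
    intro j hj
    by_contra hcon
    have hjn : n + 1 ≤ j := by
      by_contra hlt
      exact hcon ⟨(n - j).toNat, by simp only; omega⟩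
    refine hj (indicator_of_notMem ?_ _)
    have := (hx j).1
    have : ((n + 1 : ℤ) : ℝ) ≤ j := by exact_mod_cast hjn
    push_cast at this
    simp only [mem_Ioi, not_lt]
    linarith
  rw [← hinj.tsum_eq hsupp, tsum_eq_zero_add' ENNReal.summable]
  have h0 : expKernel y (s - x (n - ((0 : ℕ) : ℤ))) ≤ (centreUnion a x).indicator 1 s +
      ENNReal.ofReal (Real.exp (-(2 * a * y))) := by
    simp only [Nat.cast_zero, sub_zero]
    by_cases hpos : s - x n ∈ Ioi (0 : ℝ)
    · rw [expKernel, indicator_of_mem hpos]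
      have hpos' : 0 < s - x n := hpos
      by_cases hlt : s < x n + a
      · have : s ∈ centreUnion a x := mem_iUnion.2 ⟨n, by constructor <;> linarith⟩
        rw [indicator_of_mem this]
        refine le_trans ?_ le_self_add
        simp only [Pi.one_apply]
        rw [← ENNReal.ofReal_one]
        apply ENNReal.ofReal_le_ofReal
        rw [Real.exp_le_one_iff]
        have := mul_pos hy hpos'
        linarith
      · refine le_trans ?_ le_add_self
        apply ENNReal.ofReal_le_ofReal
        rw [Real.exp_le_exp]
        have : y * a ≤ y * (s - x n) := by gcongr; linarith
        linarith
    · rw [expKernel, indicator_of_notMem hpos]; exact zero_le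
  have h1 : ∀ i : ℕ, expKernel y (s - x (n - ((i + 1 : ℕ) : ℤ))) ≤
      ENNReal.ofReal (Real.exp (-(2 * a * y)) * Real.exp (-(2 * y)) ^ i) := by
    intro i
    refine (indicator_le_self _ _ _).trans (ENNReal.ofReal_le_ofReal ?_)
    rw [← Real.exp_nat_mul, ← Real.exp_add, Real.exp_le_exp]
    have := (hx (n - ((i + 1 : ℕ) : ℤ))).2
    push_cast at this ⊢
    have : y * (a + i) ≤ y * (s - x (n - ((i : ℤ) + 1))) := by gcongr; linarith
    linarith
  have hr0 := Real.exp_pos (-(2 * y))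
  have hr1 : Real.exp (-(2 * y)) < 1 := by rw [Real.exp_lt_one_iff]; linarith
  have h2 : ∑' i : ℕ, expKernel y (s - x (n - ((i + 1 : ℕ) : ℤ))) ≤
      ENNReal.ofReal (Real.exp (-(2 * a * y)) * (1 + 1 / (2 * y))) := by
    refine (ENNReal.tsum_le_tsum h1).trans ?_
    rw [← ENNReal.ofReal_tsum_of_nonneg (fun i => by positivity)
      ((summable_geometric_of_lt_one hr0.le hr1).mul_left _), tsum_mul_left,
      tsum_geometric_of_lt_one hr0.le hr1]
    apply ENNReal.ofReal_le_ofReal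
    gcongr
    exact inv_one_sub_exp_le hy
  refine (add_le_add h0 h2).trans (le_of_eq ?_)
  rw [add_assoc, ← ENNReal.ofReal_add (by positivity) (by positivity)]
  congr 2; ring

theorem exp_le_tsum_expKernel {a : ℝ} (ha : 0 < a) {x : ℤ → ℝ} (hx : IsCentreFamily a x) {y : ℝ}
    (hy : 0 < y) (s : ℝ) :
    ENNReal.ofReal (Real.exp (-(4 * y))) ≤ ∑' j : ℤ, expKernel y (s - x j) := by
  set n : ℤ := ⌊s⌋ with hn
  have hn1 : (n : ℝ) ≤ s := Int.floor_le s
  have hn2 : s < n + 1 := Int.lt_floor_add_one s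
  -- The centre `x n` may lie to the right of `s`; `x (n - 1)` is always to the left, at distance at
  -- most 2.
  refine le_trans ?_ (ENNReal.le_tsum (n - 1))
  have h := hx (n - 1)
  push_cast at h
  have hpos : s - x (n - 1) ∈ Ioi (0 : ℝ) := by
    simp only [mem_Ioi]; linarith
  rw [expKernel, indicator_of_mem hpos]
  apply ENNReal.ofReal_le_ofReal
  rw [Real.exp_le_exp]
  have : y * (s - x (n - 1)) ≤ y * 2 := by gcongr; linarith
  linarith

theorem tsum_lintegral_Ioi_eq {u : ℝ → ℝ≥0∞} (hu : Measurable u) (x : ℤ → ℝ) (y : ℝ) :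
    ∑' j : ℤ, ∫⁻ t in Ioi (0 : ℝ), u (x j + t) * ENNReal.ofReal (Real.exp (-(2 * y * t))) =
      ∫⁻ s, u s * ∑' j : ℤ, expKernel y (s - x j) := by
  simp_rw [← ENNReal.tsum_mul_left]
  have hk := measurable_expKernel y
  rw [lintegral_tsum fun j => by fun_prop]
  congr 1; ext j
  rw [← lintegral_indicator measurableSet_Ioi,
    ← lintegral_add_left_eq_self (fun s => u s * expKernel y (s - x j)) (x j)]
  congr 1; ext t
  rw [add_sub_cancel_left, expKernel]
  by_cases ht : t ∈ Ioi (0 : ℝ)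
  · rw [indicator_of_mem ht, indicator_of_mem ht]
  · rw [indicator_of_notMem ht, indicator_of_notMem ht, mul_zero]

/-- The bound for the horizontal `L²` norms of the Cauchy transforms at height `y`. -/
noncomputable def heightBound (a y : ℝ) (T G : ℝ≥0∞) : ℝ≥0∞ :=
  ENNReal.ofReal (2 * Real.pi) *
    (G + ENNReal.ofReal (Real.exp (-(2 * a * y)) * (2 + 1 / (2 * y))) * T)

theorem tsum_lintegral_cauchyWave_lower_le {φ : ℝ → ℂ} (hm : Measurable φ) (hφ : Integrable φ)
    {a : ℝ} (ha : 0 < a) {x : ℤ → ℝ} (hx : IsCentreFamily a x) {y : ℝ} (hy : 0 < y) :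
    ∑' j : ℤ, ∫⁻ ξ : ℝ, ‖cauchyWave φ (x j) (ξ - y * I)‖ₑ ^ 2 ≤
      heightBound a y (∫⁻ s, ‖waveIntegral φ s‖ₑ ^ 2)
        (∫⁻ s in centreUnion a x, ‖waveIntegral φ s‖ₑ ^ 2) := by
  have hu : Measurable fun s => ‖waveIntegral φ s‖ₑ ^ 2 :=
    (measurable_waveIntegral hm).enorm.pow_const 2
  simp_rw [lintegral_cauchyWave_lower hm hφ _ hy]
  rw [ENNReal.tsum_mul_left, tsum_lintegral_Ioi_eq hu, heightBound]
  gcongr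
  refine (lintegral_mono fun s => mul_le_mul_right (tsum_expKernel_le ha hx hy s) _).trans ?_
  simp_rw [mul_add]
  rw [lintegral_add_right _ (by fun_prop), lintegral_mul_const _ hu, mul_comm]
  rw [mul_comm (ENNReal.ofReal _)]
  conv_rhs => rw [mul_comm, ← lintegral_indicator (measurableSet_centreUnion a x)]
  rw [mul_comm (ENNReal.ofReal _)]
  gcongr with s
  by_cases hs : s ∈ centreUnion a x
  · rw [indicator_of_mem hs, indicator_of_mem hs, Pi.one_apply, mul_one]
  · rw [indicator_of_notMem hs, mul_zero]; exact zero_le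

theorem lintegral_wave_le_tsum {φ : ℝ → ℂ} (hm : Measurable φ) (hφ : Integrable φ)
    {a : ℝ} (ha : 0 < a) {x : ℤ → ℝ} (hx : IsCentreFamily a x) {y : ℝ} (hy : 0 < y) :
    ENNReal.ofReal (2 * Real.pi * Real.exp (-(4 * y))) * ∫⁻ s, ‖waveIntegral φ s‖ₑ ^ 2 ≤
      ∑' j : ℤ, ∫⁻ ξ : ℝ, ‖cauchyWave φ (x j) (ξ - y * I)‖ₑ ^ 2 := by
  have hu : Measurable fun s => ‖waveIntegral φ s‖ₑ ^ 2 :=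
    (measurable_waveIntegral hm).enorm.pow_const 2
  simp_rw [lintegral_cauchyWave_lower hm hφ _ hy]
  rw [ENNReal.tsum_mul_left, tsum_lintegral_Ioi_eq hu, ENNReal.ofReal_mul (by positivity), mul_assoc]
  gcongr
  rw [mul_comm, ← lintegral_mul_const _ hu]
  exact lintegral_mono fun s => mul_le_mul_right (exp_le_tsum_expKernel ha hx hy s) _

theorem waveIntegral_comp_neg (φ : ℝ → ℂ) (s : ℝ) :
    waveIntegral (fun ξ => φ (-ξ)) s = waveIntegral φ (-s) := by
  rw [waveIntegral, waveIntegral, ← integral_neg_eq_self]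
  congr 1; ext ξ; simp

theorem cauchyWave_comp_neg (φ : ℝ → ℂ) (x : ℝ) (z : ℂ) :
    cauchyWave (fun ξ => φ (-ξ)) (-x) (-z) = -cauchyWave φ x z := by
  rw [cauchyWave, cauchyWave, ← integral_neg_eq_self, ← integral_neg]
  congr 1; ext ξ
  push_cast
  rw [neg_neg, ← div_neg]
  congr 2
  · congr 1; ring
  · ring

theorem tsum_lintegral_cauchyWave_upper_le {φ : ℝ → ℂ} (hm : Measurable φ) (hφ : Integrable φ)
    {a : ℝ} (ha : 0 < a) {x : ℤ → ℝ} (hx : IsCentreFamily a x) {y : ℝ} (hy : 0 < y) :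
    ∑' j : ℤ, ∫⁻ ξ : ℝ, ‖cauchyWave φ (x j) (ξ + y * I)‖ₑ ^ 2 ≤
      heightBound a y (∫⁻ s, ‖waveIntegral φ s‖ₑ ^ 2)
        (∫⁻ s in centreUnion a x, ‖waveIntegral φ s‖ₑ ^ 2) := by
  -- The reflection `s ↦ -s` exchanges the half-planes and sends `[j, j + 1]` to `[-j - 1, -j]`.
  set e : ℤ ≃ ℤ := ⟨fun j => -j - 1, fun j => -j - 1, fun j => by ring, fun j => by ring⟩ with he
  have hx' : IsCentreFamily a fun j => -x (e j) := by
    intro j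
    have := hx (e j)
    simp only [he, Equiv.coe_fn_mk] at this ⊢
    push_cast at this
    constructor <;> linarith
  have h := tsum_lintegral_cauchyWave_lower_le (φ := fun ξ => φ (-ξ)) (hm.comp measurable_neg)
    hφ.comp_neg ha hx' hy
  have h1 : ∀ j, ∫⁻ ξ : ℝ, ‖cauchyWave (fun ξ => φ (-ξ)) (-x (e j)) (ξ - y * I)‖ₑ ^ 2 =
      ∫⁻ ξ : ℝ, ‖cauchyWave φ (x (e j)) (ξ + y * I)‖ₑ ^ 2 := by
    intro j
    rw [← lintegral_neg_eq_self]
    congr 1; ext ξ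
    rw [show (((-ξ : ℝ) : ℂ) - y * I) = -(ξ + y * I) by push_cast; ring, cauchyWave_comp_neg,
      enorm_neg]
  simp_rw [h1] at h
  rw [e.tsum_eq (fun j => ∫⁻ ξ : ℝ, ‖cauchyWave φ (x j) (ξ + y * I)‖ₑ ^ 2)] at h
  refine h.trans (le_of_eq ?_)
  simp_rw [waveIntegral_comp_neg]
  have hU : ∀ s, -s ∈ centreUnion a (fun j => -x (e j)) ↔ s ∈ centreUnion a x := by
    intro s
    simp only [centreUnion, mem_iUnion, mem_Ioo]
    refine e.exists_congr fun j => ?_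
    constructor <;> rintro ⟨h1, h2⟩ <;> constructor <;> linarith
  congr 1
  · exact lintegral_neg_eq_self (fun s => ‖waveIntegral φ s‖ₑ ^ 2)
  · rw [← lintegral_indicator (measurableSet_centreUnion _ _),
      ← lintegral_indicator (measurableSet_centreUnion _ _), ← lintegral_neg_eq_self]
    congr 1; ext s
    by_cases hs : s ∈ centreUnion a x
    · rw [indicator_of_mem hs, indicator_of_mem ((hU s).2 hs), neg_neg]
    · rw [indicator_of_notMem hs, indicator_of_notMem (fun h => hs ((hU s).1 h))]

theorem tsum_lintegral_cauchyWave_le {φ : ℝ → ℂ} (hm : Measurable φ) (hφ : Integrable φ)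
    {a : ℝ} (ha : 0 < a) {x : ℤ → ℝ} (hx : IsCentreFamily a x) {y : ℝ} (hy : y ≠ 0) :
    ∑' j : ℤ, ∫⁻ ξ : ℝ, ‖cauchyWave φ (x j) (ξ + y * I)‖ₑ ^ 2 ≤
      heightBound a |y| (∫⁻ s, ‖waveIntegral φ s‖ₑ ^ 2)
        (∫⁻ s in centreUnion a x, ‖waveIntegral φ s‖ₑ ^ 2) := by
  rcases lt_or_gt_of_ne hy with h | h
  · have := tsum_lintegral_cauchyWave_lower_le hm hφ ha hx (neg_pos.2 h)
    rw [abs_of_neg h]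
    simpa only [ofReal_neg, neg_mul, sub_neg_eq_add] using this
  · rw [abs_of_pos h]
    exact tsum_lintegral_cauchyWave_upper_le hm hφ ha hx h

/-! ### Exponential smallness in spectral gaps. -/

theorem enorm_le_lintegral_circleMap {H : ℂ → ℂ} {c : ℂ} {r : ℝ} (hr : 0 < r)
    (hd : ∀ z ∈ Metric.closedBall c r, DifferentiableAt ℂ H z) :
    ‖H c‖ₑ ≤ ENNReal.ofReal ((2 * Real.pi)⁻¹) *
      ∫⁻ θ in Ioc 0 (2 * Real.pi), ‖H (circleMap c r θ)‖ₑ := by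
  have hcl : DiffContOnCl ℂ H (Metric.ball c |r|) := by
    rw [abs_of_pos hr]
    exact DifferentiableOn.diffContOnCl fun z hz =>
      (hd z (Metric.closure_ball_subset_closedBall hz)).differentiableWithinAt
  have h := hcl.circleAverage
  rw [← h, Real.circleAverage_def, enorm_smul,
    intervalIntegral.integral_of_le (by positivity)]
  have : ‖(2 * Real.pi)⁻¹‖ₑ = ENNReal.ofReal ((2 * Real.pi)⁻¹) := by
    rw [← ofReal_norm, Real.norm_of_nonneg (by positivity)]
  rw [this]
  gcongr
  exact enorm_integral_le_lintegral_enorm _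

/-- The weight on the circle of radius `r` around `ξ - i` used in `enorm_sq_cauchyWave_le_circle`;
`y = r sin θ - 1` is the height of the point of the circle. -/
noncomputable def circleWeight (a r θ : ℝ) : ℝ :=
  4 * (r * Real.sin θ - 1) ^ 2 / r ^ 2 * Real.exp (2 * a * (|r * Real.sin θ - 1| + 1))

theorem measurable_circleWeight (a r : ℝ) : Measurable (circleWeight a r) := by
  unfold circleWeight; fun_prop

theorem circleMap_sub_I (ξ r θ : ℝ) :
    circleMap (ξ - I) r θ = ((ξ + r * Real.cos θ : ℝ) : ℂ) + ((r * Real.sin θ - 1 : ℝ) : ℂ) * I := by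
  rw [circleMap, exp_mul_I]
  push_cast; ring

/-- Mean value property for `(C q E) ^ 2` on the circle of radius `r` around `ξ - i`, which stays at
distance at least `r` from the support of `φ`. The two auxiliary factors offset the two features of
`heightBound`: the singularity at the real axis and the decay `exp(-2 a |y|)`. -/
theorem enorm_sq_cauchyWave_le_circle {φ : ℝ → ℂ} (hφ : Integrable φ) {a : ℝ} (ha : 0 < a)
    (x : ℝ) {r ξ : ℝ} (hr : 1 ≤ r) (h0 : ∀ η, |η - ξ| ≤ 2 * r → φ η = 0) :
    ‖cauchyWave φ x (ξ - I)‖ₑ ^ 2 ≤ ENNReal.ofReal (Real.exp (-(a * r)) * (2 * Real.pi)⁻¹) *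
      ∫⁻ θ in Ioc 0 (2 * Real.pi), ENNReal.ofReal (circleWeight a r θ) *
        ‖cauchyWave φ x (circleMap (ξ - I) r θ)‖ₑ ^ 2 := by
  have hrp : 0 < r := by linarith
  set c : ℂ := ξ - I with hc
  -- `q` vanishes where the circle meets the real axis, has modulus `2 |y| / r` on the circle and
  -- equals `-1` at its centre.
  set q : ℂ → ℂ := fun z => ((z - ξ) ^ 2 - (r ^ 2 - 1)) / r ^ 2 with hq
  -- `|E ^ 2|` is `exp(a r)` at the centre and `exp(2 a r sin² θ) ≤ exp(2 a (|y| + 1))` on the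
  -- circle. The decay in `|y|` pays for the latter, and the former is the gain.
  set E : ℂ → ℂ := fun z => exp (a * (r ^ 2 - (z - c) ^ 2) / (2 * r)) with hE
  have hrc : (r : ℂ) ≠ 0 := by exact_mod_cast hrp.ne'
  have hd : ∀ z ∈ Metric.closedBall c r,
      DifferentiableAt ℂ (fun z => (cauchyWave φ x z * q z * E z) ^ 2) z := by
    intro z hz
    have hF : DifferentiableAt ℂ (cauchyWave φ x) z := by
      refine differentiableAt_cauchyWave hφ x hrp fun η hη => ?_
      have h1 : 2 * r < |η - ξ| := by
        by_contra hcon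
        exact hη (h0 η (not_lt.1 hcon))
      have h2 := abs_re_le_norm ((η : ℂ) - z)
      rw [mem_closedBall_iff_norm] at hz
      have h3 := (abs_re_le_norm (z - c)).trans hz
      simp only [hc, sub_re, ofReal_re, I_re, sub_zero] at h2 h3
      have h4 := abs_add_le (η - z.re) (z.re - ξ)
      rw [sub_add_sub_cancel] at h4
      linarith
    have hq' : DifferentiableAt ℂ q z := by simp only [hq]; fun_prop
    have hE' : DifferentiableAt ℂ E z := by simp only [hE]; fun_prop
    exact ((hF.mul hq').mul hE').pow 2
  have h := enorm_le_lintegral_circleMap hrp hd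
  have hqc : q c = -1 := by
    simp only [hq, hc]
    field_simp
    linear_combination I_sq
  have hEc : ‖E c ^ 2‖ₑ = ENNReal.ofReal (Real.exp (a * r)) := by
    have : E c ^ 2 = exp ((a * r : ℝ) : ℂ) := by
      simp only [hE]
      rw [← exp_nat_mul]
      congr 1
      push_cast
      field_simp
      ring
    rw [this, ← ofReal_norm, Complex.norm_exp, ofReal_re]
  have hleft : ‖(cauchyWave φ x c * q c * E c) ^ 2‖ₑ =
      ‖cauchyWave φ x c‖ₑ ^ 2 * ENNReal.ofReal (Real.exp (a * r)) := by
    rw [mul_pow, enorm_mul, hEc, hqc, enorm_pow, mul_neg_one, enorm_neg]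
  have hcirc : ∀ θ, ‖(cauchyWave φ x (circleMap c r θ) * q (circleMap c r θ) *
      E (circleMap c r θ)) ^ 2‖ₑ ≤ ENNReal.ofReal (circleWeight a r θ) *
        ‖cauchyWave φ x (circleMap c r θ)‖ₑ ^ 2 := by
    intro θ
    rw [mul_pow, mul_pow, enorm_mul, enorm_mul, enorm_pow (cauchyWave _ _ _), mul_assoc, mul_comm]
    gcongr
    rw [← enorm_mul, ← ofReal_norm, norm_mul, circleWeight]
    apply ENNReal.ofReal_le_ofReal
    have hsc := Real.sin_sq_add_cos_sq θ
    have hw : circleMap c r θ - c = r * (Real.cos θ + Real.sin θ * I) := by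
      rw [circleMap, exp_mul_I]; push_cast; ring
    have hscc : (Real.sin θ : ℂ) ^ 2 + (Real.cos θ : ℂ) ^ 2 = 1 := by exact_mod_cast hsc
    have e1 : ‖q (circleMap c r θ) ^ 2‖ = 4 * (r * Real.sin θ - 1) ^ 2 / r ^ 2 := by
      have : q (circleMap c r θ) =
          ((2 * (r * Real.sin θ - 1) / r : ℝ) : ℂ) * ((Real.cos θ + Real.sin θ * I) * I) := by
        have hz : circleMap c r θ - ξ = r * (Real.cos θ + Real.sin θ * I) - I := by
          rw [← hw, hc]; ring
        simp only [hq, hz]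
        push_cast at hscc ⊢
        field_simp
        linear_combination ((r : ℂ) ^ 2 * sin θ ^ 2 + 1 - 2 * r * sin θ - 2 * r * sin θ * (r * sin θ - 1)) * I_sq
          + ((r : ℂ) ^ 2) * hscc
      rw [this, norm_pow, norm_mul, norm_mul, norm_I, mul_one, Complex.norm_real]
      have : ‖(Real.cos θ + Real.sin θ * I : ℂ)‖ = 1 := by
        have := norm_exp_ofReal_mul_I θ
        rwa [exp_mul_I, ← ofReal_cos, ← ofReal_sin] at this
      rw [this, mul_one, Real.norm_eq_abs, sq_abs]
      ring
    have e2 : ‖E (circleMap c r θ) ^ 2‖ = Real.exp (2 * a * (r * Real.sin θ ^ 2)) := by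
      simp only [hE]
      rw [hw, ← exp_nat_mul, Complex.norm_exp]
      congr 1
      have : ((2 : ℕ) : ℂ) * (a * (r ^ 2 - (r * (Real.cos θ + Real.sin θ * I)) ^ 2) / (2 * r)) =
          ((2 * a * (r * Real.sin θ ^ 2) : ℝ) : ℂ) + ((-2 * a * r * Real.cos θ * Real.sin θ : ℝ) : ℂ) * I := by
        push_cast at hscc ⊢
        field_simp
        linear_combination (-(a : ℂ) * sin θ ^ 2) * I_sq - a * hscc
      rw [this]
      simp only [add_re, re_ofReal_mul, I_re, mul_zero, add_zero, ofReal_re]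
    rw [e1, e2]
    gcongr
    have h1 : |Real.sin θ| ≤ 1 := Real.abs_sin_le_one θ
    have h2 : Real.sin θ ^ 2 ≤ |Real.sin θ| := by
      rw [← sq_abs]; nlinarith [abs_nonneg (Real.sin θ)]
    have h3 : r * |Real.sin θ| ≤ |r * Real.sin θ - 1| + 1 := by
      have := abs_add_le (r * Real.sin θ - 1) 1
      rw [sub_add_cancel, abs_mul, abs_of_pos hrp, abs_one] at this
      exact this
    nlinarith
  simp only [hleft] at h
  have h5 := h.trans (mul_le_mul_right (lintegral_mono hcirc) _)
  have hexp : ENNReal.ofReal (Real.exp (-(a * r))) * ENNReal.ofReal (Real.exp (a * r)) = 1 := by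
    rw [← ENNReal.ofReal_mul (Real.exp_pos _).le, ← Real.exp_add, neg_add_cancel, Real.exp_zero,
      ENNReal.ofReal_one]
  calc ‖cauchyWave φ x c‖ₑ ^ 2 = ENNReal.ofReal (Real.exp (-(a * r))) *
        (‖cauchyWave φ x c‖ₑ ^ 2 * ENNReal.ofReal (Real.exp (a * r))) := by
        rw [mul_comm (‖cauchyWave φ x c‖ₑ ^ 2), ← mul_assoc, hexp, one_mul]
    _ ≤ _ := by
        rw [ENNReal.ofReal_mul (Real.exp_pos _).le, mul_assoc]
        gcongr

theorem circleWeight_mul_heightBound_le {a : ℝ} (ha : 0 < a) {r : ℝ} (hr : 1 ≤ r) {θ : ℝ}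
    (hθ : r * Real.sin θ - 1 ≠ 0) (T G : ℝ≥0∞) :
    ENNReal.ofReal (circleWeight a r θ) * heightBound a |r * Real.sin θ - 1| T G ≤
      ENNReal.ofReal (72 * Real.pi * Real.exp (2 * a)) * T +
        ENNReal.ofReal (32 * Real.pi * Real.exp (6 * a * r)) * G := by
  set y := |r * Real.sin θ - 1| with hy
  have hyp : 0 < y := abs_pos.2 hθ
  have hrp : 0 < r := by linarith
  have hpi := Real.pi_pos
  have hy2 : y ≤ 2 * r := by
    have h1 := abs_sub (r * Real.sin θ) 1
    rw [abs_mul, abs_of_pos hrp, abs_one] at h1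
    have : r * |Real.sin θ| ≤ r * 1 := by gcongr; exact Real.abs_sin_le_one θ
    linarith
  have hcw : circleWeight a r θ = 4 * y ^ 2 / r ^ 2 * Real.exp (2 * a * (y + 1)) := by
    rw [circleWeight, hy, sq_abs]
  have hy4 : y ^ 2 / r ^ 2 ≤ 4 := by
    rw [div_le_iff₀ (by positivity)]; nlinarith
  have hy5 : y / r ^ 2 ≤ 2 := by
    rw [div_le_iff₀ (by positivity)]; nlinarith
  have hc0 : 0 ≤ circleWeight a r θ := by rw [hcw]; positivity
  rw [heightBound, ← mul_assoc, ← ENNReal.ofReal_mul hc0, mul_add (ENNReal.ofReal _), add_comm,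
    ← mul_assoc, ← ENNReal.ofReal_mul (by positivity), hcw]
  gcongr ENNReal.ofReal ?_ * _ + ENNReal.ofReal ?_ * _
  · have : 4 * y ^ 2 / r ^ 2 * Real.exp (2 * a * (y + 1)) * (2 * Real.pi) *
        (Real.exp (-(2 * a * y)) * (2 + 1 / (2 * y))) =
        8 * Real.pi * (2 * (y ^ 2 / r ^ 2) + (y / r ^ 2) / 2) * Real.exp (2 * a) := by
      rw [show 2 * a * (y + 1) = 2 * a * y + 2 * a by ring, Real.exp_add, Real.exp_neg]
      have := Real.exp_pos (2 * a * y)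
      field_simp
      ring
    have h9 : 2 * (y ^ 2 / r ^ 2) + y / r ^ 2 / 2 ≤ 9 := by linarith
    rw [this]
    calc 8 * Real.pi * (2 * (y ^ 2 / r ^ 2) + y / r ^ 2 / 2) * Real.exp (2 * a) ≤
        8 * Real.pi * 9 * Real.exp (2 * a) := by gcongr
      _ = _ := by ring
  · have : 2 * a * (y + 1) ≤ 6 * a * r := by nlinarith
    calc 4 * y ^ 2 / r ^ 2 * Real.exp (2 * a * (y + 1)) * (2 * Real.pi) =
        8 * Real.pi * (y ^ 2 / r ^ 2) * Real.exp (2 * a * (y + 1)) := by ring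
      _ ≤ 8 * Real.pi * 4 * Real.exp (6 * a * r) := by gcongr
      _ = _ := by ring

/-- The Cauchy transforms are exponentially small inside spectral gaps of radius `2 r`. -/
theorem tsum_lintegral_gap_le {φ : ℝ → ℂ} (hm : Measurable φ) (hφ : Integrable φ)
    {a : ℝ} (ha : 0 < a) {x : ℤ → ℝ} (hx : IsCentreFamily a x) {r : ℝ} (hr : 1 ≤ r)
    {S : Set ℝ} (hS : MeasurableSet S) (h0 : ∀ ξ ∈ S, ∀ η, |η - ξ| ≤ 2 * r → φ η = 0) :
    ∑' j : ℤ, ∫⁻ ξ in S, ‖cauchyWave φ (x j) (ξ - I)‖ₑ ^ 2 ≤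
      ENNReal.ofReal (Real.exp (-(a * r))) *
      (ENNReal.ofReal (72 * Real.pi * Real.exp (2 * a)) * (∫⁻ s, ‖waveIntegral φ s‖ₑ ^ 2) +
        ENNReal.ofReal (32 * Real.pi * Real.exp (6 * a * r)) *
          ∫⁻ s in centreUnion a x, ‖waveIntegral φ s‖ₑ ^ 2) := by
  set T := ∫⁻ s, ‖waveIntegral φ s‖ₑ ^ 2 with hT
  set G := ∫⁻ s in centreUnion a x, ‖waveIntegral φ s‖ₑ ^ 2 with hG
  set B := ENNReal.ofReal (72 * Real.pi * Real.exp (2 * a)) * T +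
        ENNReal.ofReal (32 * Real.pi * Real.exp (6 * a * r)) * G with hB
  set F : ℤ → ℂ → ℝ≥0∞ := fun j z => ‖cauchyWave φ (x j) z‖ₑ ^ 2 with hF
  have hFm : ∀ j, Measurable (F j) := fun j => (measurable_cauchyWave hm (x j)).enorm.pow_const 2
  have hwm := measurable_circleWeight a r
  have hjoint : ∀ j, Measurable fun p : ℝ × ℝ =>
      ENNReal.ofReal (circleWeight a r p.2) * F j (circleMap (p.1 - I) r p.2) := by
    intro j
    have : Measurable fun p : ℝ × ℝ => circleMap (p.1 - I) r p.2 := by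
      unfold circleMap; fun_prop
    exact (hwm.comp measurable_snd).ennreal_ofReal.mul ((hFm j).comp this)
  have step : ∀ j, ∫⁻ ξ in S, F j (ξ - I) ≤
      ENNReal.ofReal (Real.exp (-(a * r)) * (2 * Real.pi)⁻¹) * ∫⁻ θ in Ioc 0 (2 * Real.pi),
        ENNReal.ofReal (circleWeight a r θ) *
          ∫⁻ ξ : ℝ, F j (ξ + ((r * Real.sin θ - 1 : ℝ) : ℂ) * I) := by
    intro j
    calc ∫⁻ ξ in S, F j (ξ - I) ≤ ∫⁻ ξ in S,
          ENNReal.ofReal (Real.exp (-(a * r)) * (2 * Real.pi)⁻¹) *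
          ∫⁻ θ in Ioc 0 (2 * Real.pi), ENNReal.ofReal (circleWeight a r θ) *
            F j (circleMap (ξ - I) r θ) := by
          refine setLIntegral_mono' hS fun ξ hξ => ?_
          exact enorm_sq_cauchyWave_le_circle hφ ha (x j) hr (h0 ξ hξ)
      _ ≤ ∫⁻ ξ : ℝ,
          ENNReal.ofReal (Real.exp (-(a * r)) * (2 * Real.pi)⁻¹) *
          ∫⁻ θ in Ioc 0 (2 * Real.pi), ENNReal.ofReal (circleWeight a r θ) *
            F j (circleMap (ξ - I) r θ) := setLIntegral_le_lintegral _ _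
      _ = _ := by
          rw [lintegral_const_mul _ (hjoint j).lintegral_prod_right']
          congr 1
          rw [lintegral_lintegral_swap (hjoint j).aemeasurable]
          congr 1; ext θ
          simp_rw [circleMap_sub_I]
          have hms' : Measurable fun ξ : ℝ => F j (((ξ + r * Real.cos θ : ℝ) : ℂ) +
              ((r * Real.sin θ - 1 : ℝ) : ℂ) * I) := (hFm j).comp (by fun_prop)
          rw [lintegral_const_mul _ hms',
            lintegral_add_right_eq_self
              (fun ξ : ℝ => F j (ξ + ((r * Real.sin θ - 1 : ℝ) : ℂ) * I)) (r * Real.cos θ)]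
  refine (ENNReal.tsum_le_tsum step).trans ?_
  rw [ENNReal.tsum_mul_left, ← lintegral_tsum]
  swap
  · intro j
    have h1 : Measurable fun p : ℝ × ℝ => F j (p.2 + ((r * Real.sin p.1 - 1 : ℝ) : ℂ) * I) :=
      (hFm j).comp (by fun_prop)
    exact (hwm.ennreal_ofReal.mul h1.lintegral_prod_right').aemeasurable
  have hbound : ∀ θ, ∑' j, ENNReal.ofReal (circleWeight a r θ) *
      ∫⁻ ξ : ℝ, F j (ξ + ((r * Real.sin θ - 1 : ℝ) : ℂ) * I) ≤ B := by
    intro θ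
    rw [ENNReal.tsum_mul_left]
    by_cases hθ : r * Real.sin θ - 1 = 0
    -- On the real axis `heightBound` is not available, but the weight is zero there.
    · simp [circleWeight, hθ]
    · refine le_trans ?_ (circleWeight_mul_heightBound_le ha hr hθ T G)
      gcongr
      exact tsum_lintegral_cauchyWave_le hm hφ ha hx hθ
  calc ENNReal.ofReal (Real.exp (-(a * r)) * (2 * Real.pi)⁻¹) *
      ∫⁻ θ in Ioc 0 (2 * Real.pi), ∑' j, ENNReal.ofReal (circleWeight a r θ) *
        ∫⁻ ξ : ℝ, F j (ξ + ((r * Real.sin θ - 1 : ℝ) : ℂ) * I)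
      ≤ ENNReal.ofReal (Real.exp (-(a * r)) * (2 * Real.pi)⁻¹) *
        ∫⁻ θ in Ioc 0 (2 * Real.pi), B := by gcongr; exact hbound _
    _ = ENNReal.ofReal (Real.exp (-(a * r))) * B := by
        rw [setLIntegral_const, Real.volume_Ioc, sub_zero, mul_comm B, ← mul_assoc,
          ← ENNReal.ofReal_mul (by positivity)]
        congr 2
        have := Real.pi_pos
        field_simp

/-! ### The multiplier attached to gaps at many scales. -/

theorem exists_sum_inv_sq_add_one_le :
    ∃ C : ℝ, 0 < C ∧ ∀ (s : Finset ℤ) (ξ : ℝ), ∑ n ∈ s, 1 / (((n : ℝ) - ξ) ^ 2 + 1) ≤ C := by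
  set f : ℤ → ℝ := fun n => 4 * (1 / ((n : ℝ) ^ 2 + 1)) with hf
  have hs : Summable f := by
    refine Summable.mul_left _ ?_
    have h2 : Summable fun n : ℤ => 1 / (n : ℝ) ^ 2 :=
      (Real.summable_one_div_int_pow (p := 2)).2 (by norm_num)
    refine Summable.of_norm_bounded_eventually h2 ?_
    have : ∀ᶠ n : ℤ in cofinite, n ≠ 0 := by
      simpa using (finite_singleton (0 : ℤ)).compl_mem_cofinite
    filter_upwards [this] with n hn
    have hn' : (n : ℝ) ≠ 0 := by exact_mod_cast hn
    rw [Real.norm_of_nonneg (by positivity)]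
    gcongr
    linarith
  have hf0 : ∀ n, 0 ≤ f n := fun n => by simp only [hf]; positivity
  refine ⟨∑' n, f n + 1, add_pos_of_nonneg_of_pos (tsum_nonneg hf0) one_pos, fun s ξ => ?_⟩
  have h1 : ∀ n : ℤ, 1 / (((n : ℝ) - ξ) ^ 2 + 1) ≤ f (n - ⌊ξ⌋) := by
    intro n
    simp only [hf]
    rw [mul_one_div, div_le_div_iff₀ (by positivity) (by positivity)]
    push_cast
    have hfl := Int.floor_le ξ
    have hfu := Int.lt_floor_add_one ξ
    nlinarith [sq_nonneg ((n : ℝ) - ξ - (ξ - ⌊ξ⌋))]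
  calc ∑ n ∈ s, 1 / (((n : ℝ) - ξ) ^ 2 + 1) ≤ ∑ n ∈ s, f (n - ⌊ξ⌋) :=
        Finset.sum_le_sum fun n _ => h1 n
    _ ≤ ∑' n : ℤ, f (n - ⌊ξ⌋) :=
        ((Equiv.subRight ⌊ξ⌋).summable_iff.2 hs).sum_le_tsum s fun n _ => hf0 _
    _ = ∑' n, f n := (Equiv.subRight ⌊ξ⌋).tsum_eq f
    _ ≤ _ := by linarith

/-- The sum of the kernels `i / (n - z)` over the integers `n` with `|n - p| ≤ r`. -/
noncomputable def gapSum (p r : ℝ) (z : ℂ) : ℂ :=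
  ∑ n ∈ Finset.Icc ⌈p - r⌉ ⌊p + r⌋, I / ((n : ℂ) - z)

theorem mem_Icc_ceil_floor {p r : ℝ} {n : ℤ} :
    n ∈ Finset.Icc ⌈p - r⌉ ⌊p + r⌋ ↔ |(n : ℝ) - p| ≤ r := by
  rw [Finset.mem_Icc, Int.ceil_le, Int.le_floor, abs_le]
  constructor <;> rintro ⟨h1, h2⟩ <;> constructor <;> linarith

theorem card_Icc_ceil_floor_le {p r : ℝ} (hr : 1 ≤ r) :
    ((Finset.Icc ⌈p - r⌉ ⌊p + r⌋).card : ℝ) ≤ 3 * r := by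
  rw [Int.card_Icc]
  have h1 := Int.floor_le (p + r)
  have h2 := Int.le_ceil (p - r)
  have h3 : (((⌊p + r⌋ + 1 - ⌈p - r⌉).toNat : ℤ) : ℝ) = ((⌊p + r⌋ + 1 - ⌈p - r⌉ : ℤ) : ℝ) := by
    congr 1
    apply Int.toNat_of_nonneg
    have h4 := Int.lt_floor_add_one (p + r)
    have h5 := Int.ceil_lt_add_one (p - r)
    have : ((⌈p - r⌉ : ℤ) : ℝ) < ((⌊p + r⌋ + 1 : ℤ) : ℝ) := by push_cast; linarith
    have := Int.cast_lt.1 this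
    omega
  rw [← Int.cast_natCast, h3]
  push_cast
  linarith

theorem le_card_Icc_ceil_floor {p r : ℝ} (hr : 1 ≤ r) :
    r ≤ ((Finset.Icc ⌈p - r⌉ ⌊p + r⌋).card : ℝ) := by
  rw [Int.card_Icc]
  have h4 := Int.lt_floor_add_one (p + r)
  have h5 := Int.ceil_lt_add_one (p - r)
  have h3 : ((⌊p + r⌋ + 1 - ⌈p - r⌉ : ℤ) : ℝ) ≤ (((⌊p + r⌋ + 1 - ⌈p - r⌉).toNat : ℤ) : ℝ) := by
    exact_mod_cast Int.self_le_toNat _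
  rw [← Int.cast_natCast]
  refine le_trans ?_ h3
  push_cast
  linarith

/-- The real part is a sum of Poisson-type kernels at integer points, so it is nonnegative below the
axis. It behaves like a discretized harmonic measure of the interval of radius `r` around `p`. -/
theorem re_gapSum (p r ξ y : ℝ) :
    (gapSum p r (ξ - y * I)).re =
      ∑ n ∈ Finset.Icc ⌈p - r⌉ ⌊p + r⌋, y / (((n : ℝ) - ξ) ^ 2 + y ^ 2) := by
  rw [gapSum, re_sum]
  refine Finset.sum_congr rfl fun n _ => ?_
  rw [div_re]
  simp [normSq_apply]
  ring

/-- At most `3 r` integers contribute, each at most `1 / r ^ 2`. -/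
theorem re_gapSum_le_of_far {p r ξ : ℝ} (hr : 1 ≤ r) (h : 2 * r ≤ |ξ - p|) :
    r * (gapSum p r (ξ - I)).re ≤ 3 := by
  have h0 := re_gapSum p r ξ 1
  rw [ofReal_one, one_mul] at h0
  have hr0 : 0 < r := by linarith
  have h1 : (gapSum p r (ξ - I)).re ≤ (3 * r) * (1 / r ^ 2) := by
    rw [h0]
    refine (Finset.sum_le_card_nsmul _ _ (1 / r ^ 2) fun n hn => ?_).trans ?_
    · have h2 := mem_Icc_ceil_floor.1 hn
      have h3 := abs_sub_le ξ n p
      rw [abs_sub_comm ξ n] at h3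
      have h4 : r ≤ |(n : ℝ) - ξ| := by linarith
      have h5 : r ^ 2 ≤ ((n : ℝ) - ξ) ^ 2 := by rw [← sq_abs ((n : ℝ) - ξ)]; gcongr
      gcongr
      linarith
    · rw [nsmul_eq_mul]
      gcongr
      exact card_Icc_ceil_floor_le hr
  calc r * (gapSum p r (ξ - I)).re ≤ r * ((3 * r) * (1 / r ^ 2)) := by gcongr
    _ = 3 := by field_simp

theorem le_re_gapSum {p r ξ y L : ℝ} (hr : 1 ≤ r) (hy : 0 < y) (hyL : y ≤ L)
    (h : ∀ t, |t - p| ≤ r → |t - ξ| ≤ L) :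
    r * (y / (2 * L ^ 2)) ≤ (gapSum p r (ξ - y * I)).re := by
  rw [re_gapSum]
  have hL : 0 < L := by linarith
  refine le_trans ?_ (Finset.card_nsmul_le_sum _ _ (y / (2 * L ^ 2)) fun n hn => ?_)
  · rw [nsmul_eq_mul]
    gcongr
    exact le_card_Icc_ceil_floor hr
  · have h1 := h n (mem_Icc_ceil_floor.1 hn)
    have h2 : ((n : ℝ) - ξ) ^ 2 ≤ L ^ 2 := by rw [← sq_abs ((n : ℝ) - ξ)]; gcongr
    have h3 : y ^ 2 ≤ L ^ 2 := by gcongr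
    gcongr
    linarith

theorem differentiableOn_gapSum (p r : ℝ) : DifferentiableOn ℂ (gapSum p r) {z | z.im < 0} := by
  unfold gapSum
  refine DifferentiableOn.fun_sum fun n _ => ?_
  refine DifferentiableOn.div (by fun_prop) (by fun_prop) fun z hz h => ?_
  have hz' : z.im < 0 := hz
  have := congrArg Complex.im h
  simp at this
  linarith

theorem norm_gapSum_le (p r : ℝ) {z : ℂ} (hz : z.im ≤ -1) :
    ‖gapSum p r z‖ ≤ (Finset.Icc ⌈p - r⌉ ⌊p + r⌋).card := by
  refine (norm_sum_le _ _).trans ?_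
  refine (Finset.sum_le_card_nsmul _ _ 1 fun n _ => ?_).trans (by simp)
  rw [norm_div, norm_I]
  have := abs_im_le_norm ((n : ℂ) - z)
  rw [sub_im, intCast_im, zero_sub, abs_neg, abs_of_nonpos (by linarith)] at this
  rw [div_le_one (by linarith)]
  linarith

/-- The exponent of the outer multiplier attached to the gaps of centres `p i` and radii `r i`. -/
noncomputable def gapExponent (p r : ℕ → ℝ) (M : ℕ) (z : ℂ) : ℂ :=
  ∑ i ∈ Finset.range M, (r i : ℂ) * gapSum (p i) (r i) z

theorem re_gapExponent (p r : ℕ → ℝ) (M : ℕ) (z : ℂ) :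
    (gapExponent p r M z).re = ∑ i ∈ Finset.range M, r i * (gapSum (p i) (r i) z).re := by
  simp [gapExponent, re_sum]

/-- Induction on the number of scales. If `ξ` is near the largest gap, the crude bound `C r i` per
scale sums geometrically to `2 C r M`. Otherwise the largest gap is far away and costs at most 3 in
the exponent. -/
theorem exp_re_gapExponent_le {C c : ℝ} (hc : 0 < c)
    (hC : ∀ (s : Finset ℤ) (ξ : ℝ), ∑ n ∈ s, 1 / (((n : ℝ) - ξ) ^ 2 + 1) ≤ C)
    {p r : ℕ → ℝ} (hr : ∀ i, 1 ≤ r i) (hr2 : ∀ i, r (i + 1) = 2 * r i) (M : ℕ) (ξ : ℝ) :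
    Real.exp (2 * c * (gapExponent p r M (ξ - I)).re) ≤ Real.exp (6 * c * M) *
      (1 + ∑ i ∈ Finset.range M,
        {ξ : ℝ | |ξ - p i| < 2 * r i}.indicator (fun _ => Real.exp (4 * c * C * r i)) ξ) := by
  have hC0 : 0 ≤ C := by simpa using hC ∅ 0
  have hgeo : ∀ M, ∑ i ∈ Finset.range (M + 1), r i ≤ 2 * r M := by
    intro M
    induction M with
    | zero => simp; linarith [hr 0]
    | succ M ih => rw [Finset.sum_range_succ]; linarith [hr2 M]
  have hterm : ∀ i, r i * (gapSum (p i) (r i) (ξ - I)).re ≤ C * r i := by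
    intro i
    have h0 := re_gapSum (p i) (r i) ξ 1
    rw [ofReal_one, one_mul] at h0
    have h1 := hC (Finset.Icc ⌈p i - r i⌉ ⌊p i + r i⌋) ξ
    rw [h0, mul_comm C]
    have := hr i
    gcongr
    simpa using h1
  have hind : ∀ i, 0 ≤ {ξ : ℝ | |ξ - p i| < 2 * r i}.indicator
      (fun _ => Real.exp (4 * c * C * r i)) ξ :=
    fun i => indicator_nonneg (fun _ _ => (Real.exp_pos _).le) _
  induction M with
  | zero => simp [gapExponent]
  | succ M ih =>
    have hsum0 : 0 ≤ ∑ i ∈ Finset.range M, {ξ : ℝ | |ξ - p i| < 2 * r i}.indicator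
      (fun _ => Real.exp (4 * c * C * r i)) ξ := Finset.sum_nonneg fun i _ => hind i
    by_cases hM : |ξ - p M| < 2 * r M
    · have h1 : (gapExponent p r (M + 1) (ξ - I)).re ≤ 2 * C * r M := by
        rw [re_gapExponent]
        calc _ ≤ ∑ i ∈ Finset.range (M + 1), C * r i := Finset.sum_le_sum fun i _ => hterm i
          _ = C * ∑ i ∈ Finset.range (M + 1), r i := by rw [Finset.mul_sum]
          _ ≤ C * (2 * r M) := by gcongr; exact hgeo M
          _ = _ := by ring
      rw [Finset.sum_range_succ, indicator_of_mem (by exact hM)]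
      have h2 : 1 ≤ Real.exp (6 * c * ((M + 1 : ℕ) : ℝ)) := Real.one_le_exp (by positivity)
      calc Real.exp (2 * c * (gapExponent p r (M + 1) (ξ - I)).re)
          ≤ Real.exp (4 * c * C * r M) := by
            rw [Real.exp_le_exp]
            calc 2 * c * (gapExponent p r (M + 1) (ξ - I)).re ≤ 2 * c * (2 * C * r M) := by gcongr
              _ = _ := by ring
        _ = 1 * Real.exp (4 * c * C * r M) := by rw [one_mul]
        _ ≤ _ := by
            gcongr
            linarith
    · rw [Finset.sum_range_succ, indicator_of_notMem (by exact hM), add_zero]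
      have h1 : (gapExponent p r (M + 1) (ξ - I)).re ≤ (gapExponent p r M (ξ - I)).re + 3 := by
        rw [re_gapExponent, re_gapExponent, Finset.sum_range_succ]
        gcongr
        exact re_gapSum_le_of_far (hr M) (not_lt.1 hM)
      calc Real.exp (2 * c * (gapExponent p r (M + 1) (ξ - I)).re)
          ≤ Real.exp (2 * c * ((gapExponent p r M (ξ - I)).re + 3)) := by gcongr
        _ = Real.exp (6 * c) * Real.exp (2 * c * (gapExponent p r M (ξ - I)).re) := by
            rw [← Real.exp_add]; ring_nf
        _ ≤ Real.exp (6 * c) * (Real.exp (6 * c * M) * (1 + ∑ i ∈ Finset.range M,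
            {ξ : ℝ | |ξ - p i| < 2 * r i}.indicator (fun _ => Real.exp (4 * c * C * r i)) ξ)) := by
            gcongr
        _ = _ := by
            rw [← mul_assoc, ← Real.exp_add]
            congr 2
            push_cast
            ring

/-- Poisson majorization of a Cauchy transform times the outer multiplier of the gaps. -/
theorem enorm_sq_cauchyWave_mul_exp_le {φ : ℝ → ℂ} (hφ : Integrable φ) (x : ℝ) {c : ℝ}
    (p r : ℕ → ℝ) (M : ℕ) (ξ₀ : ℝ) {y : ℝ} (hy : 0 < y) :
    ‖cauchyWave φ x (ξ₀ - (1 + y : ℝ) * I)‖ₑ ^ 2 *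
        ENNReal.ofReal (Real.exp (2 * c * (gapExponent p r M (ξ₀ - (1 + y : ℝ) * I)).re)) ≤
      ∫⁻ ξ : ℝ, ‖cauchyWave φ x (ξ - I)‖ₑ ^ 2 *
        ENNReal.ofReal (Real.exp (2 * c * (gapExponent p r M (ξ - I)).re)) *
        ENNReal.ofReal (y / Real.pi * ((ξ - ξ₀) ^ 2 + y ^ 2)⁻¹) := by
  set g := gapExponent p r M with hg
  have hgd : DifferentiableOn ℂ g {z | z.im < 0} := by
    simp only [hg]
    unfold gapExponent
    exact DifferentiableOn.fun_sum fun i _ => (differentiableOn_gapSum _ _).const_mul _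
  obtain ⟨B, hB⟩ : ∃ B, ∀ z : ℂ, z.im ≤ -1 → ‖g z‖ ≤ B := by
    refine ⟨∑ i ∈ Finset.range M, |r i| * (Finset.Icc ⌈p i - r i⌉ ⌊p i + r i⌋).card,
      fun z hz => ?_⟩
    refine (norm_sum_le _ _).trans (Finset.sum_le_sum fun i _ => ?_)
    rw [norm_mul, norm_real, Real.norm_eq_abs]
    gcongr
    exact norm_gapSum_le _ _ hz
  have hW : ∀ z, ‖(cauchyWave φ x z * exp (c * g z)) ^ 2‖ₑ =
      ‖cauchyWave φ x z‖ₑ ^ 2 * ENNReal.ofReal (Real.exp (2 * c * (g z).re)) := by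
    intro z
    rw [mul_pow, enorm_mul, enorm_pow, ← exp_nat_mul, ← ofReal_norm (exp _), Complex.norm_exp]
    congr 3
    simp
    ring
  have h := enorm_le_lintegral_poisson (H := fun z => (cauchyWave φ x z * exp (c * g z)) ^ 2)
    (((differentiableOn_cauchyWave hφ x).mul (hgd.const_mul _).cexp).pow 2)
    (B := ((∫ ξ, ‖φ ξ‖) * Real.exp (|c| * B)) ^ 2) ?_ ξ₀ hy
  · simp only [hW] at h
    push_cast
    exact h
  · intro z hz
    rw [norm_pow, norm_mul]
    gcongr
    · exact norm_cauchyWave_le hφ x hz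
    · rw [Complex.norm_exp]
      gcongr
      refine (re_le_norm _).trans ?_
      rw [norm_mul, norm_real, Real.norm_eq_abs]
      gcongr
      exact hB z hz

/-! ### Propagation from the line `Im z = -1` to a larger depth. -/

/-- At every scale `2 ^ m` with `m ≥ m₀`, the function `φ` vanishes on an interval of radius
`4 l 2 ^ m` around `p m n` inside the dyadic interval `[2 ^ m n, 2 ^ m (n + 1)]`. -/
def IsGapFamily (l : ℝ) (m₀ : ℕ) (φ : ℝ → ℂ) (p : ℕ → ℤ → ℝ) : Prop :=
  ∀ m : ℕ, m₀ ≤ m → ∀ n : ℤ, 2 ^ m * (n : ℝ) ≤ p m n - 4 * (l * 2 ^ m) ∧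
    p m n + 4 * (l * 2 ^ m) ≤ 2 ^ m * ((n : ℝ) + 1) ∧
    ∀ η : ℝ, |η - p m n| ≤ 4 * (l * 2 ^ m) → φ η = 0

/-- The union of the middle halves of the gaps at scale `2 ^ m`. -/
def gapUnion (l : ℝ) (p : ℕ → ℤ → ℝ) (m : ℕ) : Set ℝ :=
  ⋃ n : ℤ, {ξ : ℝ | |ξ - p m n| < 2 * (l * 2 ^ m)}

theorem measurableSet_gapUnion (l : ℝ) (p : ℕ → ℤ → ℝ) (m : ℕ) :
    MeasurableSet (gapUnion l p m) :=
  MeasurableSet.iUnion fun _ => measurableSet_lt (by fun_prop) measurable_const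

/-- The indicator of the pairs at distance at most `L`. -/
noncomputable def nearIndicator (L : ℝ) (q : ℝ × ℝ) : ℝ≥0∞ :=
  {q : ℝ × ℝ | |q.2 - q.1| ≤ L}.indicator 1 q

theorem measurable_nearIndicator (L : ℝ) : Measurable (nearIndicator L) :=
  Measurable.indicator measurable_const (measurableSet_le (by fun_prop) measurable_const)

theorem lintegral_nearIndicator (L ξ : ℝ) :
    ∫⁻ ξ₀, nearIndicator L (ξ₀, ξ) = ENNReal.ofReal (2 * L) := by
  have : ∀ ξ₀, nearIndicator L (ξ₀, ξ) = (Icc (ξ - L) (ξ + L)).indicator 1 ξ₀ := by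
    intro ξ₀
    unfold nearIndicator
    by_cases h : |ξ - ξ₀| ≤ L
    · rw [indicator_of_mem (by exact h), indicator_of_mem]
      · rfl
      · rw [abs_le] at h; constructor <;> linarith
    · rw [indicator_of_notMem (by exact h), indicator_of_notMem]
      intro h2
      refine h (abs_le.2 ?_)
      constructor <;> linarith [h2.1, h2.2]
  simp_rw [this]
  rw [lintegral_indicator_one measurableSet_Icc, Real.volume_Icc]
  congr 1; ring

theorem lintegral_poisson (ξ : ℝ) {y : ℝ} (hy : 0 < y) :
    ∫⁻ ξ₀ : ℝ, ENNReal.ofReal (y / Real.pi * ((ξ - ξ₀) ^ 2 + y ^ 2)⁻¹) = 1 := by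
  have hpi := Real.pi_pos
  have hsymm : ∀ ξ₀ : ℝ, (ξ - ξ₀) ^ 2 = (ξ₀ - ξ) ^ 2 := fun ξ₀ => by ring
  simp_rw [hsymm]
  rw [← ofReal_integral_eq_lintegral_ofReal ((integrable_poisson ξ hy).const_mul _)
    (Eventually.of_forall fun t => by positivity), integral_const_mul, integral_poisson ξ hy]
  rw [div_mul_div_cancel₀ hpi.ne', div_self hy.ne', ENNReal.ofReal_one]

/-- The depth `1 + 8 / l ^ 2` is chosen so that each scale contributes at least `l ^ 2 (8 / l ^ 2) /
2 = 4` to the exponent below `ξ₀`, beating the cost 3 on the line: the net factor is `exp(6 c M - 8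
c M)`. -/
theorem enorm_sq_cauchyWave_le_of_gaps {φ : ℝ → ℂ} (hm : Measurable φ) (hφ : Integrable φ)
    {l : ℝ} (hl : 0 < l) (hl1 : l ≤ 1) {m₀ : ℕ} (hm₀ : 1 ≤ l * 2 ^ m₀)
    (hm₁ : 1 + 8 / l ^ 2 ≤ 2 ^ m₀) {p : ℕ → ℤ → ℝ} (hp : IsGapFamily l m₀ φ p) (x : ℝ)
    {c C : ℝ} (hc : 0 < c)
    (hC : ∀ (s : Finset ℤ) (ξ : ℝ), ∑ n ∈ s, 1 / (((n : ℝ) - ξ) ^ 2 + 1) ≤ C) (M : ℕ) (ξ₀ : ℝ) :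
    ‖cauchyWave φ x (ξ₀ - (1 + 8 / l ^ 2 : ℝ) * I)‖ₑ ^ 2 ≤
      ENNReal.ofReal (Real.exp (-(2 * c * M))) *
      ((∫⁻ ξ : ℝ, ‖cauchyWave φ x (ξ - I)‖ₑ ^ 2 *
          ENNReal.ofReal (8 / l ^ 2 / Real.pi * ((ξ - ξ₀) ^ 2 + (8 / l ^ 2) ^ 2)⁻¹)) +
        ∑ i ∈ Finset.range M, ENNReal.ofReal (Real.exp (4 * c * C * (l * 2 ^ (m₀ + i)))) *
          ∫⁻ ξ in gapUnion l p (m₀ + i), ‖cauchyWave φ x (ξ - I)‖ₑ ^ 2 *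
            nearIndicator (2 ^ (m₀ + i)) (ξ₀, ξ)) := by
  set y : ℝ := 8 / l ^ 2 with hy
  have hy8 : 8 ≤ y := by
    rw [hy, le_div_iff₀ (by positivity)]; nlinarith
  have hy0 : 0 < y := by linarith
  set r : ℕ → ℝ := fun i => l * 2 ^ (m₀ + i) with hrdef
  -- At each scale the gap used is the one in the dyadic interval containing `ξ₀`.
  set N : ℕ → ℤ := fun i => ⌊ξ₀ / 2 ^ (m₀ + i)⌋ with hN
  set q : ℕ → ℝ := fun i => p (m₀ + i) (N i) with hq
  have hpow : ∀ i, (2 : ℝ) ^ m₀ ≤ 2 ^ (m₀ + i) := fun i =>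
    pow_le_pow_right₀ (by norm_num) (by omega)
  have hr : ∀ i, 1 ≤ r i := fun i => hm₀.trans (by simp only [hrdef]; gcongr; exacts [by norm_num, by omega])
  have hr2 : ∀ i, r (i + 1) = 2 * r i := fun i => by simp only [hrdef]; ring
  have hnear : ∀ i t, |t - q i| ≤ 4 * r i → |t - ξ₀| ≤ 2 ^ (m₀ + i) := by
    intro i t ht
    have hL : (0 : ℝ) < 2 ^ (m₀ + i) := by positivity
    obtain ⟨h1, h2, -⟩ := hp (m₀ + i) (by omega) (N i)
    have h3 := Int.floor_le (ξ₀ / 2 ^ (m₀ + i))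
    have h4 := Int.lt_floor_add_one (ξ₀ / 2 ^ (m₀ + i))
    rw [le_div_iff₀ hL] at h3
    rw [div_lt_iff₀ hL] at h4
    rw [abs_le] at ht ⊢
    simp only [hq, hrdef, hN] at *
    constructor <;> linarith
  have hlow : 4 * (M : ℝ) ≤ (gapExponent q r M (ξ₀ - (1 + y : ℝ) * I)).re := by
    rw [re_gapExponent]
    have : ∀ i ∈ Finset.range M, 4 ≤ r i * (gapSum (q i) (r i) (ξ₀ - (1 + y : ℝ) * I)).re := by
      intro i _
      have hri := hr i
      have h := le_re_gapSum (p := q i) (ξ := ξ₀) (y := 1 + y) (L := 2 ^ (m₀ + i)) hri (by linarith)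
        (hm₁.trans (hpow i)) (fun t ht => hnear i t (by linarith))
      calc (4 : ℝ) = l ^ 2 * y / 2 := by rw [hy]; field_simp; norm_num
        _ ≤ l ^ 2 * (1 + y) / 2 := by gcongr; linarith
        _ = r i * (r i * ((1 + y) / (2 * (2 ^ (m₀ + i)) ^ 2))) := by
            simp only [hrdef]; field_simp
        _ ≤ _ := by gcongr
    have h := Finset.card_nsmul_le_sum _ _ _ this
    rw [Finset.card_range, nsmul_eq_mul] at h
    linarith
  set u : ℝ → ℝ≥0∞ := fun ξ => ‖cauchyWave φ x (ξ - I)‖ₑ ^ 2 with hu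
  have hum : Measurable u := ((measurable_cauchyWave hm x).comp (by fun_prop)).enorm.pow_const 2
  set P : ℝ → ℝ≥0∞ := fun ξ => ENNReal.ofReal (y / Real.pi * ((ξ - ξ₀) ^ 2 + y ^ 2)⁻¹) with hP
  have hPm : Measurable P := by simp only [hP]; fun_prop
  have hpi := Real.pi_gt_three
  have hP1 : ∀ ξ, P ξ ≤ 1 := by
    intro ξ
    simp only [hP]
    rw [← ENNReal.ofReal_one]
    apply ENNReal.ofReal_le_ofReal
    rw [div_mul_eq_mul_div, div_le_one (by positivity), ← div_eq_mul_inv,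
      div_le_iff₀ (by positivity)]
    nlinarith [sq_nonneg (ξ - ξ₀)]
  have hmain := enorm_sq_cauchyWave_mul_exp_le hφ x (c := c) q r M ξ₀ hy0
  have hpt : ∀ ξ, u ξ * ENNReal.ofReal (Real.exp (2 * c * (gapExponent q r M (ξ - I)).re)) * P ξ ≤
      ENNReal.ofReal (Real.exp (6 * c * M)) * (u ξ * P ξ + ∑ i ∈ Finset.range M,
        ENNReal.ofReal (Real.exp (4 * c * C * r i)) *
          (gapUnion l p (m₀ + i)).indicator (fun ξ => u ξ * nearIndicator (2 ^ (m₀ + i)) (ξ₀, ξ)) ξ) := by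
    intro ξ
    have h := ENNReal.ofReal_le_ofReal (exp_re_gapExponent_le hc hC hr hr2 (p := q) M ξ)
    have hind : ∀ i, 0 ≤ {ξ : ℝ | |ξ - q i| < 2 * r i}.indicator
        (fun _ => Real.exp (4 * c * C * r i)) ξ :=
      fun i => indicator_nonneg (fun _ _ => (Real.exp_pos _).le) _
    rw [ENNReal.ofReal_mul (Real.exp_pos _).le,
      ENNReal.ofReal_add zero_le_one (Finset.sum_nonneg fun i _ => hind i),
      ENNReal.ofReal_sum_of_nonneg fun i _ => hind i, ENNReal.ofReal_one] at h
    calc u ξ * ENNReal.ofReal (Real.exp (2 * c * (gapExponent q r M (ξ - I)).re)) * P ξ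
        ≤ u ξ * (ENNReal.ofReal (Real.exp (6 * c * M)) * (1 + ∑ i ∈ Finset.range M,
          ENNReal.ofReal ({ξ : ℝ | |ξ - q i| < 2 * r i}.indicator
            (fun _ => Real.exp (4 * c * C * r i)) ξ))) * P ξ := by gcongr
      _ = ENNReal.ofReal (Real.exp (6 * c * M)) * (u ξ * P ξ + ∑ i ∈ Finset.range M,
          ENNReal.ofReal ({ξ : ℝ | |ξ - q i| < 2 * r i}.indicator
            (fun _ => Real.exp (4 * c * C * r i)) ξ) * (u ξ * P ξ)) := by
          rw [← Finset.sum_mul]; ring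
      _ ≤ _ := by
          -- The gap depends on `ξ₀`; it is replaced by the union of all gaps of its scale together
          -- with the condition `|ξ - ξ₀| ≤ 2 ^ (m₀ + i)`, which makes Fubini in `ξ₀` possible.
          refine mul_le_mul_right (add_le_add le_rfl (Finset.sum_le_sum fun i _ => ?_)) _
          by_cases hi : |ξ - q i| < 2 * r i
          · have hri := hr i
            have hmem : ξ ∈ gapUnion l p (m₀ + i) := mem_iUnion.2 ⟨N i, hi⟩
            rw [indicator_of_mem (by exact hi), indicator_of_mem hmem]
            have : nearIndicator (2 ^ (m₀ + i)) (ξ₀, ξ) = 1 :=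
              indicator_of_mem (by exact hnear i ξ (by linarith)) _
            rw [this]
            gcongr
            exact hP1 ξ
          · rw [indicator_of_notMem (by exact hi), ENNReal.ofReal_zero, zero_mul]
            exact zero_le
  have hmeas : ∀ i, Measurable fun ξ => ENNReal.ofReal (Real.exp (4 * c * C * r i)) *
      (gapUnion l p (m₀ + i)).indicator (fun ξ => u ξ * nearIndicator (2 ^ (m₀ + i)) (ξ₀, ξ)) ξ := by
    intro i
    refine measurable_const.mul (Measurable.indicator ?_ (measurableSet_gapUnion _ _ _))
    exact hum.mul ((measurable_nearIndicator _).comp (by fun_prop))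
  have hint := hmain.trans (lintegral_mono hpt)
  have huP : Measurable fun ξ => u ξ * P ξ := hum.mul hPm
  have hall : Measurable fun ξ => u ξ * P ξ + ∑ i ∈ Finset.range M,
      ENNReal.ofReal (Real.exp (4 * c * C * r i)) *
        (gapUnion l p (m₀ + i)).indicator (fun ξ => u ξ * nearIndicator (2 ^ (m₀ + i)) (ξ₀, ξ)) ξ :=
    huP.add (Finset.measurable_sum _ fun i _ => hmeas i)
  rw [lintegral_const_mul _ hall, lintegral_add_left huP, lintegral_finsetSum _ fun i _ => hmeas i] at hint
  have hsum : ∀ i, ∫⁻ ξ, ENNReal.ofReal (Real.exp (4 * c * C * r i)) *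
      (gapUnion l p (m₀ + i)).indicator (fun ξ => u ξ * nearIndicator (2 ^ (m₀ + i)) (ξ₀, ξ)) ξ =
      ENNReal.ofReal (Real.exp (4 * c * C * r i)) * ∫⁻ ξ in gapUnion l p (m₀ + i),
        u ξ * nearIndicator (2 ^ (m₀ + i)) (ξ₀, ξ) := by
    intro i
    rw [← lintegral_indicator (measurableSet_gapUnion _ _ _), lintegral_const_mul]
    exact (hum.mul ((measurable_nearIndicator _).comp (by fun_prop))).indicator
      (measurableSet_gapUnion _ _ _)
  simp_rw [hsum] at hint
  set R := (∫⁻ ξ, u ξ * P ξ) + ∑ i ∈ Finset.range M, ENNReal.ofReal (Real.exp (4 * c * C * r i)) *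
    ∫⁻ ξ in gapUnion l p (m₀ + i), u ξ * nearIndicator (2 ^ (m₀ + i)) (ξ₀, ξ) with hR
  change _ ≤ ENNReal.ofReal (Real.exp (-(2 * c * M))) * R
  have hone : ENNReal.ofReal (Real.exp (-(8 * c * M))) * ENNReal.ofReal (Real.exp (8 * c * M)) = 1 := by
    rw [← ENNReal.ofReal_mul (Real.exp_pos _).le, ← Real.exp_add, neg_add_cancel, Real.exp_zero,
      ENNReal.ofReal_one]
  calc ‖cauchyWave φ x (ξ₀ - (1 + y : ℝ) * I)‖ₑ ^ 2
      = ENNReal.ofReal (Real.exp (-(8 * c * M))) * (‖cauchyWave φ x (ξ₀ - (1 + y : ℝ) * I)‖ₑ ^ 2 *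
          ENNReal.ofReal (Real.exp (8 * c * M))) := by
        rw [mul_comm (‖_‖ₑ ^ 2), ← mul_assoc, hone, one_mul]
    _ ≤ ENNReal.ofReal (Real.exp (-(8 * c * M))) * (‖cauchyWave φ x (ξ₀ - (1 + y : ℝ) * I)‖ₑ ^ 2 *
          ENNReal.ofReal (Real.exp (2 * c * (gapExponent q r M (ξ₀ - (1 + y : ℝ) * I)).re))) := by
        gcongr ENNReal.ofReal _ * (_ * ENNReal.ofReal (Real.exp ?_))
        calc 8 * c * M = 2 * c * (4 * M) := by ring
          _ ≤ _ := by gcongr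
    _ ≤ ENNReal.ofReal (Real.exp (-(8 * c * M))) * (ENNReal.ofReal (Real.exp (6 * c * M)) * R) := by
        gcongr
    _ = _ := by
        rw [← mul_assoc, ← ENNReal.ofReal_mul (Real.exp_pos _).le, ← Real.exp_add]
        congr 3; ring

/-- Integration in `ξ₀`: the Poisson kernel has mass 1, and the proximity condition contributes its
length `2 * 2 ^ (m₀ + i)`. -/
theorem lintegral_cauchyWave_le_of_gaps {φ : ℝ → ℂ} (hm : Measurable φ) (hφ : Integrable φ)
    {l : ℝ} (hl : 0 < l) (hl1 : l ≤ 1) {m₀ : ℕ} (hm₀ : 1 ≤ l * 2 ^ m₀)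
    (hm₁ : 1 + 8 / l ^ 2 ≤ 2 ^ m₀) {p : ℕ → ℤ → ℝ} (hp : IsGapFamily l m₀ φ p) (x : ℝ)
    {c C : ℝ} (hc : 0 < c)
    (hC : ∀ (s : Finset ℤ) (ξ : ℝ), ∑ n ∈ s, 1 / (((n : ℝ) - ξ) ^ 2 + 1) ≤ C) (M : ℕ) :
    ∫⁻ ξ₀ : ℝ, ‖cauchyWave φ x (ξ₀ - (1 + 8 / l ^ 2 : ℝ) * I)‖ₑ ^ 2 ≤
      ENNReal.ofReal (Real.exp (-(2 * c * M))) *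
      ((∫⁻ ξ : ℝ, ‖cauchyWave φ x (ξ - I)‖ₑ ^ 2) +
        ∑ i ∈ Finset.range M, ENNReal.ofReal (Real.exp (4 * c * C * (l * 2 ^ (m₀ + i)))) *
          (ENNReal.ofReal (2 * 2 ^ (m₀ + i)) *
            ∫⁻ ξ in gapUnion l p (m₀ + i), ‖cauchyWave φ x (ξ - I)‖ₑ ^ 2)) := by
  set y : ℝ := 8 / l ^ 2 with hy
  have hy0 : 0 < y := by positivity
  set u : ℝ → ℝ≥0∞ := fun ξ => ‖cauchyWave φ x (ξ - I)‖ₑ ^ 2 with hu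
  have hum : Measurable u := ((measurable_cauchyWave hm x).comp (by fun_prop)).enorm.pow_const 2
  have hm1 : Measurable fun q : ℝ × ℝ =>
      u q.2 * ENNReal.ofReal (y / Real.pi * ((q.2 - q.1) ^ 2 + y ^ 2)⁻¹) :=
    (hum.comp measurable_snd).mul (by fun_prop)
  have hm2 : ∀ L : ℝ, Measurable fun q : ℝ × ℝ => u q.2 * nearIndicator L q := fun L =>
    (hum.comp measurable_snd).mul (measurable_nearIndicator L)
  have hm3 : ∀ i : ℕ, Measurable fun ξ₀ : ℝ =>
      ENNReal.ofReal (Real.exp (4 * c * C * (l * 2 ^ (m₀ + i)))) *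
        ∫⁻ ξ in gapUnion l p (m₀ + i), u ξ * nearIndicator (2 ^ (m₀ + i)) (ξ₀, ξ) := fun i =>
    measurable_const.mul (hm2 _).lintegral_prod_right'
  refine (lintegral_mono fun ξ₀ =>
    enorm_sq_cauchyWave_le_of_gaps hm hφ hl hl1 hm₀ hm₁ hp x hc hC M ξ₀).trans ?_
  have hm4 : Measurable fun ξ₀ : ℝ =>
      ∫⁻ ξ, u ξ * ENNReal.ofReal (y / Real.pi * ((ξ - ξ₀) ^ 2 + y ^ 2)⁻¹) :=
    hm1.lintegral_prod_right'
  have hm5 : Measurable fun ξ₀ : ℝ =>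
      (∫⁻ ξ, u ξ * ENNReal.ofReal (y / Real.pi * ((ξ - ξ₀) ^ 2 + y ^ 2)⁻¹)) +
      ∑ i ∈ Finset.range M, ENNReal.ofReal (Real.exp (4 * c * C * (l * 2 ^ (m₀ + i)))) *
        ∫⁻ ξ in gapUnion l p (m₀ + i), u ξ * nearIndicator (2 ^ (m₀ + i)) (ξ₀, ξ) :=
    hm4.add (Finset.measurable_sum _ fun i _ => hm3 i)
  rw [lintegral_const_mul _ hm5, lintegral_add_left hm4, lintegral_finsetSum _ fun i _ => hm3 i]
  refine mul_le_mul_right (add_le_add (le_of_eq ?_) (Finset.sum_le_sum fun i _ => le_of_eq ?_)) _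
  · rw [lintegral_lintegral_swap hm1.aemeasurable]
    congr 1; ext ξ
    rw [lintegral_const_mul _ (by fun_prop), lintegral_poisson ξ hy0, mul_one]
  · rw [lintegral_const_mul _ (hm2 _).lintegral_prod_right']
    congr 1
    rw [lintegral_lintegral_swap (hm2 _).aemeasurable, mul_comm, ← lintegral_mul_const _ hum]
    congr 1; ext ξ
    have hn : Measurable fun ξ₀ : ℝ => nearIndicator (2 ^ (m₀ + i)) (ξ₀, ξ) :=
      (measurable_nearIndicator _).comp (by fun_prop)
    change ∫⁻ ξ₀, u ξ * nearIndicator (2 ^ (m₀ + i)) (ξ₀, ξ) = _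
    rw [lintegral_const_mul _ hn, lintegral_nearIndicator]

/-! ### Choice of constants and absorption. -/

/-- The relative weight of the `i`-th scale is summable. -/
theorem scale_weight_le {a l : ℝ} (ha : 0 < a) (hl : 0 < l) {m₀ : ℕ} (hm₀ : 1 ≤ l * 2 ^ m₀)
    (i : ℕ) : Real.exp (a / 2 * (l * 2 ^ (m₀ + i))) * (2 * 2 ^ (m₀ + i)) *
      Real.exp (-(a * (l * 2 ^ (m₀ + i)))) ≤ 16 / (l * a ^ 2) * (1 / 2) ^ i := by
  set r := l * 2 ^ (m₀ + i) with hr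
  have h2i : (2 : ℝ) ^ i ≤ r := by
    rw [hr, pow_add, ← mul_assoc]
    exact le_mul_of_one_le_left (by positivity) hm₀
  have hr0 : 0 < r := by positivity
  have hexp : Real.exp (a / 2 * r) * Real.exp (-(a * r)) = (Real.exp (a * r / 2))⁻¹ := by
    rw [← Real.exp_add, ← Real.exp_neg]; congr 1; ring
  have hquad : (a * r / 2) ^ 2 / 2 ≤ Real.exp (a * r / 2) := by
    have := Real.quadratic_le_exp_of_nonneg (x := a * r / 2) (by positivity)
    have : 0 < a * r / 2 := by positivity
    linarith
  have hr' : (2 : ℝ) ^ (m₀ + i) = r / l := by rw [hr]; field_simp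
  calc Real.exp (a / 2 * r) * (2 * 2 ^ (m₀ + i)) * Real.exp (-(a * r))
      = (2 * (r / l)) * (Real.exp (a * r / 2))⁻¹ := by rw [← hexp, hr']; ring
    _ ≤ (2 * (r / l)) * ((a * r / 2) ^ 2 / 2)⁻¹ := by gcongr
    _ = 16 / (l * a ^ 2) * (1 / r) := by field_simp; norm_num
    _ ≤ 16 / (l * a ^ 2) * (1 / 2 ^ i) := by gcongr
    _ = _ := by rw [one_div_pow]

/-- Uncertainty estimate: a function whose spectrum has a gap of proportional size in every dyadic
interval of length at least `2 ^ m₀` cannot concentrate away from the centre intervals. -/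
theorem exists_lintegral_wave_le (a l : ℝ) (ha : 0 < a) (hl : 0 < l) (hl1 : l ≤ 1) (m₀ : ℕ)
    (hm₀ : 1 ≤ l * 2 ^ m₀) (hm₁ : 1 + 8 / l ^ 2 ≤ 2 ^ m₀) :
    ∃ D : ℝ, 0 < D ∧ ∀ φ : ℝ → ℂ, Measurable φ → Integrable φ →
      ∀ x : ℤ → ℝ, IsCentreFamily a x → ∀ p : ℕ → ℤ → ℝ, IsGapFamily l m₀ φ p →
      ∫⁻ s, ‖waveIntegral φ s‖ₑ ^ 2 ≠ ⊤ →
      ∫⁻ s, ‖waveIntegral φ s‖ₑ ^ 2 ≤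
        ENNReal.ofReal D * ∫⁻ s in centreUnion a x, ‖waveIntegral φ s‖ₑ ^ 2 := by
  obtain ⟨C, hC0, hC⟩ := exists_sum_inv_sq_add_one_le
  -- Then `4 c C = a / 2`, so the multiplier costs `exp(a r / 2)` in a gap against the gain `exp(-a
  -- r)`.
  set c : ℝ := a / (8 * C) with hcdef
  have hc : 0 < c := by positivity
  have hpi := Real.pi_pos
  set y : ℝ := 1 + 8 / l ^ 2 with hy
  have hy0 : 0 < y := by positivity
  set κ : ℝ := 2 * Real.pi * Real.exp (-(4 * y)) with hκ
  have hκ0 : 0 < κ := by positivity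
  set α : ℝ := 72 * Real.pi * Real.exp (2 * a) with hα
  set w : ℕ → ℝ := fun i => 16 / (l * a ^ 2) * (1 / 2) ^ i with hw
  have hw0 : ∀ i, 0 ≤ w i := fun i => by simp only [hw]; positivity
  -- The coefficient of `T` must not depend on `M`: the scale weights are bounded by their full
  -- geometric sum. The coefficient `B` of `G` may depend on `M`.
  set A : ℝ := 5 * Real.pi + 32 / (l * a ^ 2) * α with hA
  have hA0 : 0 < A := by positivity
  obtain ⟨M, hM⟩ : ∃ M : ℕ, Real.exp (-(2 * c * M)) * A ≤ κ / 2 := by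
    have h1 : Tendsto (fun M : ℕ => Real.exp (-(2 * c * M)) * A) atTop (𝓝 (0 * A)) := by
      refine Tendsto.mul_const _ (Real.tendsto_exp_neg_atTop_nhds_zero.comp ?_)
      exact tendsto_natCast_atTop_atTop.const_mul_atTop (by positivity)
    rw [zero_mul] at h1
    exact ((h1.eventually (gt_mem_nhds (half_pos hκ0))).exists).imp fun M h => h.le
  set b : ℕ → ℝ := fun i => 32 * Real.pi * Real.exp (6 * a * (l * 2 ^ (m₀ + i))) with hb
  set B : ℝ := 2 * Real.pi + ∑ i ∈ Finset.range M, w i * b i with hB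
  have hb0 : ∀ i, 0 ≤ b i := fun i => by simp only [hb]; positivity
  have hB0 : 0 < B := by
    have : 0 ≤ ∑ i ∈ Finset.range M, w i * b i :=
      Finset.sum_nonneg fun i _ => mul_nonneg (hw0 i) (hb0 i)
    positivity
  refine ⟨2 * B / κ, by positivity, fun φ hm hφ x hx p hp hfin => ?_⟩
  set T := ∫⁻ s, ‖waveIntegral φ s‖ₑ ^ 2 with hT
  set G := ∫⁻ s in centreUnion a x, ‖waveIntegral φ s‖ₑ ^ 2 with hG
  have hlower := lintegral_wave_le_tsum hm hφ ha hx hy0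
  have hupper := hlower.trans (ENNReal.tsum_le_tsum fun j =>
    lintegral_cauchyWave_le_of_gaps hm hφ hl hl1 hm₀ hm₁ hp (x j) hc hC M)
  rw [ENNReal.tsum_mul_left, ENNReal.tsum_add,
    Summable.tsum_finsetSum fun _ _ => ENNReal.summable] at hupper
  simp_rw [ENNReal.tsum_mul_left] at hupper
  have hA1 : ∑' j : ℤ, ∫⁻ ξ : ℝ, ‖cauchyWave φ (x j) (ξ - I)‖ₑ ^ 2 ≤
      ENNReal.ofReal (5 * Real.pi) * T + ENNReal.ofReal (2 * Real.pi) * G := by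
    have h := tsum_lintegral_cauchyWave_lower_le hm hφ ha hx one_pos
    simp only [ofReal_one, one_mul] at h
    refine h.trans ?_
    rw [heightBound, mul_add, add_comm, ← mul_assoc, ← ENNReal.ofReal_mul (by positivity)]
    gcongr ENNReal.ofReal ?_ * _ + _
    have : Real.exp (-(2 * a * 1)) ≤ 1 := by rw [Real.exp_le_one_iff]; linarith
    calc 2 * Real.pi * (Real.exp (-(2 * a * 1)) * (2 + 1 / (2 * 1))) ≤
        2 * Real.pi * (1 * (2 + 1 / (2 * 1))) := by gcongr
      _ = 5 * Real.pi := by ring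
  have hE : ∀ i, ENNReal.ofReal (Real.exp (4 * c * C * (l * 2 ^ (m₀ + i)))) *
      (ENNReal.ofReal (2 * 2 ^ (m₀ + i)) *
        ∑' j : ℤ, ∫⁻ ξ in gapUnion l p (m₀ + i), ‖cauchyWave φ (x j) (ξ - I)‖ₑ ^ 2) ≤
      ENNReal.ofReal (w i * α) * T + ENNReal.ofReal (w i * b i) * G := by
    intro i
    have hr : 1 ≤ l * 2 ^ (m₀ + i) := hm₀.trans (by gcongr; exacts [by norm_num, by omega])
    have h := tsum_lintegral_gap_le hm hφ ha hx hr (measurableSet_gapUnion l p (m₀ + i)) (by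
      intro ξ hξ η hη
      obtain ⟨n, hn⟩ := mem_iUnion.1 hξ
      have hn' : |ξ - p (m₀ + i) n| < 2 * (l * 2 ^ (m₀ + i)) := hn
      refine (hp (m₀ + i) (by omega) n).2.2 η ?_
      have := abs_sub_le η ξ (p (m₀ + i) n)
      linarith)
    have hcC : 4 * c * C = a / 2 := by rw [hcdef]; field_simp; norm_num
    have hsw := scale_weight_le ha hl hm₀ i
    rw [hcC]
    calc _ ≤ ENNReal.ofReal (Real.exp (a / 2 * (l * 2 ^ (m₀ + i)))) *
          (ENNReal.ofReal (2 * 2 ^ (m₀ + i)) * (ENNReal.ofReal (Real.exp (-(a * (l * 2 ^ (m₀ + i))))) *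
            (ENNReal.ofReal α * T + ENNReal.ofReal (b i) * G))) := by gcongr
      _ = ENNReal.ofReal (Real.exp (a / 2 * (l * 2 ^ (m₀ + i))) * (2 * 2 ^ (m₀ + i)) *
            Real.exp (-(a * (l * 2 ^ (m₀ + i))))) * (ENNReal.ofReal α * T + ENNReal.ofReal (b i) * G) := by
          rw [ENNReal.ofReal_mul
              (p := Real.exp (a / 2 * (l * 2 ^ (m₀ + i))) * (2 * 2 ^ (m₀ + i))) (by positivity),
            ENNReal.ofReal_mul (p := Real.exp (a / 2 * (l * 2 ^ (m₀ + i)))) (by positivity)]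
          ring
      _ ≤ ENNReal.ofReal (w i) * (ENNReal.ofReal α * T + ENNReal.ofReal (b i) * G) := by
          gcongr
      _ = _ := by
          rw [ENNReal.ofReal_mul (hw0 i), ENNReal.ofReal_mul (hw0 i)]
          ring
  have hsumw : ∑ i ∈ Finset.range M, w i * α ≤ 32 / (l * a ^ 2) * α := by
    rw [← Finset.sum_mul]
    gcongr
    simp only [hw]
    rw [← Finset.mul_sum]
    have h2 : ∑ i ∈ Finset.range M, (1 / 2 : ℝ) ^ i ≤ 2 :=
      (summable_geometric_two.sum_le_tsum _ fun i _ => by positivity).trans_eq tsum_geometric_two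
    calc 16 / (l * a ^ 2) * ∑ i ∈ Finset.range M, (1 / 2 : ℝ) ^ i ≤ 16 / (l * a ^ 2) * 2 := by
          gcongr
      _ = _ := by ring
  have hsum : ∑ i ∈ Finset.range M, (ENNReal.ofReal (w i * α) * T + ENNReal.ofReal (w i * b i) * G) ≤
      ENNReal.ofReal (32 / (l * a ^ 2) * α) * T +
        ENNReal.ofReal (∑ i ∈ Finset.range M, w i * b i) * G := by
    rw [Finset.sum_add_distrib, ← Finset.sum_mul, ← Finset.sum_mul,
      ← ENNReal.ofReal_sum_of_nonneg fun i _ => mul_nonneg (hw0 i) (by positivity),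
      ← ENNReal.ofReal_sum_of_nonneg fun i _ => mul_nonneg (hw0 i) (hb0 i)]
    gcongr
  have hS0 : 0 ≤ ∑ i ∈ Finset.range M, w i * b i :=
    Finset.sum_nonneg fun i _ => mul_nonneg (hw0 i) (hb0 i)
  have htot : ENNReal.ofReal κ * T ≤ ENNReal.ofReal (κ / 2) * T + ENNReal.ofReal B * G := by
    calc ENNReal.ofReal κ * T ≤ ENNReal.ofReal (Real.exp (-(2 * c * M))) *
          ((ENNReal.ofReal (5 * Real.pi) * T + ENNReal.ofReal (2 * Real.pi) * G) +
          (ENNReal.ofReal (32 / (l * a ^ 2) * α) * T +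
            ENNReal.ofReal (∑ i ∈ Finset.range M, w i * b i) * G)) := by
          refine hupper.trans ?_
          gcongr
          exact (Finset.sum_le_sum fun i _ => hE i).trans hsum
      _ = ENNReal.ofReal (Real.exp (-(2 * c * M)) * A) * T +
          ENNReal.ofReal (Real.exp (-(2 * c * M)) * B) * G := by
          rw [ENNReal.ofReal_mul (Real.exp_pos _).le, ENNReal.ofReal_mul (Real.exp_pos _).le, hA, hB,
            ENNReal.ofReal_add (by positivity) (by positivity),
            ENNReal.ofReal_add (by positivity) hS0]
          ring
      _ ≤ _ := by
          gcongr ENNReal.ofReal ?_ * _ + ENNReal.ofReal ?_ * _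
          have : Real.exp (-(2 * c * M)) ≤ 1 := by
            rw [Real.exp_le_one_iff]
            have : 0 ≤ 2 * c * M := by positivity
            linarith
          exact mul_le_of_le_one_left hB0.le this
  have hsplit : ENNReal.ofReal κ * T = ENNReal.ofReal (κ / 2) * T + ENNReal.ofReal (κ / 2) * T := by
    rw [← add_mul, ← ENNReal.ofReal_add (by positivity) (by positivity), add_halves]
  -- Half of `κ T` is cancelled from both sides; this is where `T` has to be finite.
  rw [hsplit, ENNReal.add_le_add_iff_left (ENNReal.mul_ne_top ENNReal.ofReal_ne_top hfin)] at htot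
  have hk1 : ENNReal.ofReal (2 / κ) * ENNReal.ofReal (κ / 2) = 1 := by
    rw [← ENNReal.ofReal_mul (by positivity), ← ENNReal.ofReal_one]
    congr 1; field_simp
  calc T = ENNReal.ofReal (2 / κ) * (ENNReal.ofReal (κ / 2) * T) := by
        rw [← mul_assoc, hk1, one_mul]
    _ ≤ ENNReal.ofReal (2 / κ) * (ENNReal.ofReal B * G) := by gcongr
    _ = _ := by
        rw [← mul_assoc, ← ENNReal.ofReal_mul (by positivity)]
        congr 2; ring

/-! ### Holes from porosity, rescaling, and the conclusion. -/

theorem exists_centre_of_ordConnected {J : Set ℝ} (hJ : J.OrdConnected) {A B s : ℝ} (hs : 0 < s)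
    (hAB : J ⊆ Icc A B) (hv : ENNReal.ofReal s ≤ volume J) :
    ∃ c : ℝ, A ≤ c - s / 2 ∧ c + s / 2 ≤ B ∧ Ioo (c - s / 2) (c + s / 2) ⊆ J := by
  have hne : J.Nonempty := by
    by_contra h
    rw [not_nonempty_iff_eq_empty] at h
    rw [h, measure_empty, nonpos_iff_eq_zero, ENNReal.ofReal_eq_zero] at hv
    linarith
  have hbb : BddBelow J := bddBelow_Icc.mono hAB
  have hba : BddAbove J := bddAbove_Icc.mono hAB
  have hsub : J ⊆ Icc (sInf J) (sSup J) := fun t ht => ⟨csInf_le hbb ht, le_csSup hba ht⟩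
  have hlen : s ≤ sSup J - sInf J := by
    have h1 := hv.trans (measure_mono hsub)
    rw [Real.volume_Icc] at h1
    by_contra hcon
    push Not at hcon
    exact absurd h1 (not_le.2 ((ENNReal.ofReal_lt_ofReal_iff hs).2 hcon))
  have hA : A ≤ sInf J := le_csInf hne fun t ht => (hAB ht).1
  have hB : sSup J ≤ B := csSup_le hne fun t ht => (hAB ht).2
  refine ⟨(sInf J + sSup J) / 2, by linarith, by linarith, fun t ht => ?_⟩
  obtain ⟨t1, h1, h1'⟩ := exists_lt_of_csInf_lt hne (show sInf J < t by linarith [ht.1])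
  obtain ⟨t2, h2, h2'⟩ := exists_lt_of_lt_csSup hne (show t < sSup J by linarith [ht.2])
  exact hJ.out h1 h2 ⟨h1'.le, h2'.le⟩

theorem isIntervalOfLength_Icc (A : ℝ) {s : ℝ} : IsIntervalOfLength (Icc A (A + s)) s :=
  ⟨ordConnected_Icc, by rw [Real.volume_Icc, add_sub_cancel_left]⟩

/-- Dilates of a porous subset of the unit interval have holes at all large scales. -/
theorem IsPorous.exists_hole_dilate {ν h : ℝ} {Y : Set ℝ} (hY : Y ⊆ Icc 0 1)
    (hp : IsPorous ν h 1 Y) {N : ℝ} (hN : 1 ≤ N) (hNh : h * N ≤ 1) {A L : ℝ} (hL : 4 ≤ L) :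
    ∃ p : ℝ, A ≤ p - ν * L / 8 ∧ p + ν * L / 8 ≤ A + L ∧
      ∀ t ∈ Y, ν * L / 8 ≤ |N * t - p| := by
  have hν0 := hp.nu_pos
  have hν1 := hp.nu_lt_one
  have hN0 : 0 < N := by linarith
  have hνL : ν * L ≤ L := mul_le_of_le_one_left (by linarith) hν1.le
  -- If `L / 4 ≤ N`, porosity applies to the interval `[A, A + L / 4]` divided by `N`. Otherwise `N
  -- Y` lies in `[0, N]`, shorter than `L / 4`, and leaves room near one end of `[A, A + L]`.
  by_cases hcase : L / 4 ≤ N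
  · set s : ℝ := L / (4 * N) with hs
    have hs0 : 0 < s := by positivity
    have hhs : h ≤ s := by
      rw [hs, le_div_iff₀ (by positivity)]
      linarith
    have hs1 : s ≤ 1 := by
      rw [hs, div_le_one (by positivity)]
      linarith
    obtain ⟨J, hJI, ⟨hJ, hJv⟩, hJY⟩ := hp.hole _ s (isIntervalOfLength_Icc (A / N)) hhs hs1
    obtain ⟨c, hc1, hc2, hc3⟩ := exists_centre_of_ordConnected hJ (mul_pos hν0 hs0) hJI hJv.ge
    have hsN : N * (ν * s / 2) = ν * L / 8 := by rw [hs]; field_simp; norm_num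
    have hAN : N * (A / N) = A := by field_simp
    have hsN2 : N * s = L / 4 := by rw [hs]; field_simp
    refine ⟨N * c, ?_, ?_, fun t ht => ?_⟩
    · have := mul_le_mul_of_nonneg_left hc1 hN0.le
      linarith
    · have := mul_le_mul_of_nonneg_left hc2 hN0.le
      linarith
    · rw [← mul_sub, abs_mul, abs_of_pos hN0, ← hsN]
      gcongr
      by_contra hcon
      push Not at hcon
      rw [abs_lt] at hcon
      exact disjoint_left.1 hJY (hc3 ⟨by linarith [hcon.1], by linarith [hcon.2]⟩) ht
  · push Not at hcase
    have hYN : ∀ t ∈ Y, 0 ≤ N * t ∧ N * t ≤ N := fun t ht =>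
      ⟨mul_nonneg hN0.le (hY ht).1, mul_le_of_le_one_right hN0.le (hY ht).2⟩
    by_cases hA : N ≤ A + L / 2
    · refine ⟨A + 3 * L / 4, by linarith, by linarith, fun t ht => ?_⟩
      rw [abs_sub_comm]
      refine le_trans ?_ (le_abs_self _)
      linarith [(hYN t ht).2]
    · push Not at hA
      refine ⟨A + L / 8, by linarith, by linarith, fun t ht => ?_⟩
      refine le_trans ?_ (le_abs_self _)
      linarith [(hYN t ht).1]

theorem ae_eq_zero_off_essSupp (u : ℝ → ℂ) : ∀ᵐ ξ, ξ ∉ essSupp u → u ξ = 0 := by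
  rw [ae_iff]
  refine measure_null_of_locally_null _ fun ξ hξ => ?_
  have hξ' : ξ ∉ essSupp u ∧ u ξ ≠ 0 := by
    have : ¬(ξ ∉ essSupp u → u ξ = 0) := hξ
    tauto
  have h1 : ∃ V ∈ 𝓝 ξ, u =ᵐ[volume.restrict V] 0 := by
    have : ¬∀ V ∈ 𝓝 ξ, ¬u =ᵐ[volume.restrict V] 0 := hξ'.1
    push Not at this
    exact this
  obtain ⟨V, hV, hu⟩ := h1
  obtain ⟨W, hWV, hWo, hW⟩ := mem_nhds_iff.1 hV
  refine ⟨W ∩ {ξ | ¬(ξ ∉ essSupp u → u ξ = 0)},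
    inter_mem (mem_nhdsWithin_of_mem_nhds (hWo.mem_nhds hW)) self_mem_nhdsWithin, ?_⟩
  have hu2 : ∀ᵐ t ∂volume.restrict W, u t = 0 := ae_restrict_of_ae_restrict_of_subset hWV hu
  rw [ae_restrict_iff' hWo.measurableSet, ae_iff] at hu2
  refine measure_mono_null (fun t ht => ?_) hu2
  have h2 : ¬(t ∉ essSupp u → u t = 0) := ht.2
  have h3 := ht.1
  change ¬(t ∈ W → u t = 0)
  tauto

/-- One change of variables handles both the dilation by `μ` and the `2π` in the normalization of
the Fourier transform. -/
theorem waveIntegral_comp_div (ψ : ℝ → ℂ) {μ : ℝ} (hμ : 0 < μ) (s : ℝ) :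
    waveIntegral (fun ξ => ψ (ξ / (2 * Real.pi / μ))) s =
      ((2 * Real.pi / μ : ℝ) : ℂ) * 𝓕⁻ ψ (s / μ) := by
  set b : ℝ := 2 * Real.pi / μ with hb
  have hpi := Real.pi_pos
  have hb0 : 0 < b := by positivity
  have h : ∀ ξ : ℝ, ψ (ξ / b) * exp (s * ξ * I) =
      (fun η : ℝ => ψ η * exp (s * (b * η : ℝ) * I)) (ξ / b) := by
    intro ξ
    simp only
    rw [mul_div_cancel₀ ξ hb0.ne']
  rw [waveIntegral]
  simp_rw [h]
  rw [Measure.integral_comp_div (fun η : ℝ => ψ η * exp (s * (b * η : ℝ) * I)) b, abs_of_pos hb0,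
    Real.fourierInv_eq', Complex.real_smul]
  congr 2; ext η
  rw [smul_eq_mul, mul_comm]
  congr 2
  rw [hb]
  simp
  ring

theorem isCompact_smul_add_Icc {Y : Set ℝ} (hY : Y ⊆ Icc 0 1) (hc : IsClosed Y) (t A B : ℝ) :
    IsCompact (t • Y + Icc A B) :=
  ((isCompact_Icc.of_isClosed_subset hc hY).smul t).add isCompact_Icc

/-- An `L²` function with compactly supported Fourier transform is the inverse Fourier integral of
an integrable function with the same spectral support. -/
theorem exists_integrable_fourierInv_ae_eq (f : Lp ℂ 2 (volume : Measure ℝ)) {Z : Set ℝ}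
    (hZ : IsCompact Z) (hf : essSupp (fourierHat f) ⊆ Z) :
    ∃ ψ : ℝ → ℂ, Measurable ψ ∧ Integrable ψ ∧ (f =ᵐ[volume] 𝓕⁻ ψ) ∧
      ∀ η, ψ η ≠ 0 → 2 * Real.pi * η ∈ Z := by
  have hpi := Real.pi_pos
  set v : Lp ℂ 2 (volume : Measure ℝ) := 𝓕 f with hv
  set S : Set ℝ := (fun η : ℝ => 2 * Real.pi * η) ⁻¹' Z with hS
  have hSm : MeasurableSet S := hZ.measurableSet.preimage (by fun_prop)
  have hSc : IsCompact S :=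
    (Homeomorph.mulLeft₀ (2 * Real.pi) (by positivity)).isCompact_preimage.2 hZ
  have hvm : Measurable (v : ℝ → ℂ) := (Lp.stronglyMeasurable v).measurable
  have hv0 : ∀ᵐ η : ℝ, η ∉ S → v η = 0 := by
    have h1 := ae_eq_zero_off_essSupp (fourierHat f)
    have hq : Measure.QuasiMeasurePreserving (fun η : ℝ => (2 * Real.pi) * η) volume volume := by
      refine ⟨by fun_prop, ?_⟩
      rw [Real.map_volume_mul_left (by positivity)]
      exact Measure.smul_absolutelyContinuous
    filter_upwards [hq.ae h1] with η hη hηS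
    have h2 := hη fun h => hηS (hf h)
    rwa [fourierHat, mul_div_cancel_left₀ _ (by positivity)] at h2
  have hae : S.indicator v =ᵐ[volume] v := by
    filter_upwards [hv0] with η hη
    by_cases h : η ∈ S
    · rw [indicator_of_mem h]
    · rw [indicator_of_notMem h, hη h]
  -- Cutting off to the compact set `S` changes `v` only on a null set, and an `L²` function
  -- supported there is integrable.
  have hL2 : MemLp (S.indicator v) 2 := (Lp.memLp v).indicator hSm
  have hL1 : Integrable (S.indicator v) := by
    rw [integrable_indicator_iff hSm]
    have : IsFiniteMeasure (volume.restrict S) :=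
      ⟨by rw [Measure.restrict_apply_univ]; exact hSc.measure_lt_top⟩
    exact ((Lp.memLp v).restrict S).integrable (by norm_num)
  refine ⟨S.indicator v, hvm.indicator hSm, hL1, ?_, fun η hη => ?_⟩
  · have h1 : hL2.toLp (S.indicator v) = v := by
      apply Lp.ext
      exact hL2.coeFn_toLp.trans hae
    have h2 := toLp_fourierInv_ae_eq_integral hL1 hL2
    rw [h1, hv, FourierTransform.fourierInv_fourier_eq] at h2
    exact h2
  · exact (mem_of_indicator_ne_zero hη : η ∈ S)

theorem mainTheorem5 (ν : ℝ) (hν₀ : 0 < ν) (hν₁ : ν < 1) :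
    ∃ c : ℝ, 0 < c ∧
      ∀ (h : ℝ) (K : ℕ), ((2 : ℝ) ^ (K + 1))⁻¹ ≤ h → h ≤ ((2 : ℝ) ^ K)⁻¹ →
      ∀ X Y : Set ℝ, X ⊆ Set.Icc 0 1 → Y ⊆ Set.Icc 0 1 →
        IsPorous ν h 1 X → IsPorous ν h 1 Y →
      ∀ k : ℕ, k ≤ K →
      ∀ I' : ℤ → Set ℝ, IsHoleFamily ν X k I' →
      ∀ f : MeasureTheory.Lp ℂ 2 (MeasureTheory.volume : MeasureTheory.Measure ℝ),
        essSupp (fourierHat f) ⊆ h⁻¹ • Y + Set.Icc (-(2 : ℝ) ^ k) ((2 : ℝ) ^ k) →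
        ENNReal.ofReal c * MeasureTheory.eLpNorm f 2 MeasureTheory.volume ≤
          MeasureTheory.eLpNorm f 2 (MeasureTheory.volume.restrict (⋃ j : ℤ, I' j)) := by
  have hpi := Real.pi_pos
  -- The holes of the dilated `Y` have radius `ν L / 8`. With `4 l L = ν L / 16`, half of this
  -- radius remains to accommodate the unit neighbourhood of the spectrum once `ν L ≥ 64`, which
  -- follows from `1 ≤ l * 2 ^ m₀`.
  set l : ℝ := ν / 64 with hl
  have hl0 : 0 < l := by positivity
  obtain ⟨m₀, hm₀⟩ : ∃ m₀ : ℕ, max (1 / l) (1 + 8 / l ^ 2) ≤ (2 : ℝ) ^ m₀ :=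
    (pow_unbounded_of_one_lt _ one_lt_two).imp fun _ h => h.le
  have hm1 : 1 ≤ l * 2 ^ m₀ := by
    have := (le_max_left _ _).trans hm₀
    rwa [div_le_iff₀' hl0] at this
  obtain ⟨D, hD, hmain⟩ := exists_lintegral_wave_le (ν / 2) l (by positivity) hl0
    (by rw [hl]; linarith) m₀ hm1 ((le_max_right _ _).trans hm₀)
  refine ⟨√(1 / D), by positivity, ?_⟩
  intro h K _ hhK X Y _ hY _ hpY k hk I' hI' f hf
  have hh0 : 0 < h := hpY.scale_pos
  set μ : ℝ := 2 ^ k with hμ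
  have hμ0 : 0 < μ := by positivity
  have hμ1 : 1 ≤ μ := one_le_pow₀ one_le_two
  have hhμ : h * μ ≤ 1 := by
    have h1 : μ ≤ 2 ^ K := pow_le_pow_right₀ one_le_two hk
    have h2 : h * 2 ^ K ≤ 1 := by rwa [← le_div_iff₀ (by positivity), one_div]
    exact (mul_le_mul_of_nonneg_left h1 hh0.le).trans h2
  obtain ⟨ψ, hψm, hψi, hfψ, hψZ⟩ := exists_integrable_fourierInv_ae_eq f
    (isCompact_smul_add_Icc hY hpY.isClosed h⁻¹ (-μ) μ) hf
  set b : ℝ := 2 * Real.pi / μ with hb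
  have hb0 : 0 < b := by positivity
  set φ : ℝ → ℂ := fun ξ => ψ (ξ / b) with hφ
  have hφm : Measurable φ := hψm.comp (by fun_prop)
  have hφi : Integrable φ := hψi.comp_div hb0.ne'
  -- the centres of the holes
  have hcentre : ∀ j : ℤ, ∃ c : ℝ, μ⁻¹ * (j : ℝ) ≤ c - ν * μ⁻¹ / 2 ∧
      c + ν * μ⁻¹ / 2 ≤ μ⁻¹ * ((j : ℝ) + 1) ∧
      Ioo (c - ν * μ⁻¹ / 2) (c + ν * μ⁻¹ / 2) ⊆ I' j := fun j =>
    exists_centre_of_ordConnected (hI' j).2.1.1 (by positivity) (hI' j).1 (hI' j).2.1.2.ge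
  choose ctr hc1 hc2 hc3 using hcentre
  set x : ℤ → ℝ := fun j => μ * ctr j with hx
  have hμinv : μ * μ⁻¹ = 1 := mul_inv_cancel₀ hμ0.ne'
  have hcf : IsCentreFamily (ν / 2) x := by
    intro j
    have h1 := mul_le_mul_of_nonneg_left (hc1 j) hμ0.le
    have h2 := mul_le_mul_of_nonneg_left (hc2 j) hμ0.le
    simp only [hx]
    constructor
    · calc (j : ℝ) = μ * (μ⁻¹ * j) := by rw [← mul_assoc, hμinv, one_mul]
        _ ≤ μ * (ctr j - ν * μ⁻¹ / 2) := h1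
        _ = μ * ctr j - ν / 2 := by field_simp
    · calc μ * ctr j + ν / 2 = μ * (ctr j + ν * μ⁻¹ / 2) := by field_simp
        _ ≤ μ * (μ⁻¹ * (j + 1)) := h2
        _ = j + 1 := by rw [← mul_assoc, hμinv, one_mul]
  -- the gaps of the spectrum
  set N : ℝ := 1 / (h * μ) with hN
  have hN1 : 1 ≤ N := by rw [hN, le_div_iff₀ (by positivity)]; linarith
  have hNh : h * N ≤ 1 := by
    have : h * N = 1 / μ := by rw [hN]; field_simp
    rw [this, div_le_one hμ0]; exact hμ1
  have hsupp : ∀ ξ, φ ξ ≠ 0 → ∃ t ∈ Y, |ξ - N * t| ≤ 1 := by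
    intro ξ hξ
    have h1 := hψZ _ hξ
    have h2 : 2 * Real.pi * (ξ / b) = μ * ξ := by rw [hb]; field_simp
    rw [h2] at h1
    obtain ⟨z, hz, w, hw, hzw⟩ := mem_add.1 h1
    obtain ⟨t, ht, rfl⟩ := mem_smul_set.1 hz
    refine ⟨t, ht, ?_⟩
    have h3 : ξ - N * t = w / μ := by
      rw [smul_eq_mul] at hzw
      rw [hN, eq_div_iff hμ0.ne']
      field_simp at hzw ⊢
      linarith
    rw [h3, abs_div, abs_of_pos hμ0, div_le_one hμ0]
    exact abs_le.2 hw
  have hlν : 64 ≤ ν * 2 ^ m₀ := by rw [hl] at hm1; linarith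
  have hgap : ∀ (m : ℕ) (n : ℤ), ∃ p : ℝ, m₀ ≤ m → 2 ^ m * (n : ℝ) ≤ p - 4 * (l * 2 ^ m) ∧
      p + 4 * (l * 2 ^ m) ≤ 2 ^ m * ((n : ℝ) + 1) ∧
      ∀ η : ℝ, |η - p| ≤ 4 * (l * 2 ^ m) → φ η = 0 := by
    intro m n
    by_cases hm : m₀ ≤ m
    swap
    · exact ⟨0, fun h => absurd h hm⟩
    have hL : 64 ≤ ν * 2 ^ m := hlν.trans (by gcongr; exact one_le_two)
    have hL4 : (4 : ℝ) ≤ 2 ^ m := by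
      have : ν * 2 ^ m ≤ 1 * 2 ^ m := by gcongr
      linarith
    obtain ⟨p, hp1, hp2, hp3⟩ := hpY.exists_hole_dilate hY hN1 hNh (A := 2 ^ m * n) hL4
    have hlm : 4 * (l * 2 ^ m) = ν * 2 ^ m / 16 := by rw [hl]; ring
    rw [hlm]
    refine ⟨p, fun _ => ⟨by linarith, by linarith, fun η hη => ?_⟩⟩
    by_contra hne
    obtain ⟨t, ht, htη⟩ := hsupp η hne
    have h1 := hp3 t ht
    have h2 := abs_sub_le (N * t) η p
    rw [abs_sub_comm (N * t) η] at h2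
    linarith
  choose p hp using hgap
  -- comparison of the norms
  have hψc : Measurable (𝓕⁻ ψ) := by
    have h1 : Continuous (𝓕 ψ) :=
      VectorFourier.fourierIntegral_continuous Real.continuous_fourierChar (by fun_prop) hψi
    have : 𝓕⁻ ψ = fun x => 𝓕 ψ (-x) := by ext x; exact Real.fourierInv_eq_fourier_neg ψ x
    rw [this]
    exact (h1.comp continuous_neg).measurable
  set g : ℝ → ℝ≥0∞ := fun s => ENNReal.ofReal (b ^ 2) * ‖𝓕⁻ ψ s‖ₑ ^ 2 with hg
  have hgm : Measurable g := measurable_const.mul (hψc.enorm.pow_const 2)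
  have hwave : ∀ s, ‖waveIntegral φ s‖ₑ ^ 2 = g (s / μ) := by
    intro s
    rw [hφ, waveIntegral_comp_div ψ hμ0, enorm_mul, mul_pow, hg]
    congr 1
    rw [← ofReal_norm, norm_real, Real.norm_of_nonneg hb0.le, ENNReal.ofReal_pow hb0.le]
  have hgint : ∀ U : Set ℝ, ∫⁻ s in U, g s =
      ENNReal.ofReal (b ^ 2) * eLpNorm f 2 (volume.restrict U) ^ 2 := by
    intro U
    rw [← lintegral_enorm_sq_eq_eLpNorm_sq, hg, lintegral_const_mul _ (hψc.enorm.pow_const 2)]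
    congr 1
    refine lintegral_congr_ae (ae_restrict_of_ae ?_)
    filter_upwards [hfψ] with s hs
    rw [hs]
  have hTeq : ∫⁻ s, ‖waveIntegral φ s‖ₑ ^ 2 =
      ENNReal.ofReal μ * (ENNReal.ofReal (b ^ 2) * eLpNorm f 2 volume ^ 2) := by
    simp_rw [hwave]
    rw [lintegral_comp_div hgm hμ0, ← setLIntegral_univ, hgint, Measure.restrict_univ]
  have hGle : ∫⁻ s in centreUnion (ν / 2) x, ‖waveIntegral φ s‖ₑ ^ 2 ≤
      ENNReal.ofReal μ * (ENNReal.ofReal (b ^ 2) *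
        eLpNorm f 2 (volume.restrict (⋃ j : ℤ, I' j)) ^ 2) := by
    set V : Set ℝ := ⋃ j : ℤ, Ioo (ctr j - ν * μ⁻¹ / 2) (ctr j + ν * μ⁻¹ / 2) with hV
    have hVm : MeasurableSet V := MeasurableSet.iUnion fun _ => measurableSet_Ioo
    rw [← hgint]
    simp_rw [hwave]
    calc ∫⁻ s in centreUnion (ν / 2) x, g (s / μ)
        ≤ ∫⁻ s, V.indicator g (s / μ) := by
          rw [← lintegral_indicator (measurableSet_centreUnion _ _)]
          refine lintegral_mono fun s => ?_
          by_cases hs : s ∈ centreUnion (ν / 2) x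
          swap
          · rw [indicator_of_notMem hs]; exact zero_le
          obtain ⟨j, hj⟩ := mem_iUnion.1 hs
          have : s / μ ∈ V := by
            refine mem_iUnion.2 ⟨j, ?_, ?_⟩
            · rw [lt_div_iff₀ hμ0]
              calc (ctr j - ν * μ⁻¹ / 2) * μ = μ * ctr j - ν / 2 := by field_simp
                _ < s := hj.1
            · rw [div_lt_iff₀ hμ0]
              calc s < μ * ctr j + ν / 2 := hj.2
                _ = (ctr j + ν * μ⁻¹ / 2) * μ := by field_simp
          rw [indicator_of_mem hs, indicator_of_mem this]
      _ = ENNReal.ofReal μ * ∫⁻ s in V, g s := by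
          rw [lintegral_comp_div (hgm.indicator hVm) hμ0, lintegral_indicator hVm]
      _ ≤ _ := by
          gcongr
          exact iUnion_mono hc3
  have hfin : ∫⁻ s, ‖waveIntegral φ s‖ₑ ^ 2 ≠ ⊤ := by
    rw [hTeq]
    exact ENNReal.mul_ne_top ENNReal.ofReal_ne_top (ENNReal.mul_ne_top ENNReal.ofReal_ne_top
      (ENNReal.pow_ne_top (Lp.memLp f).eLpNorm_ne_top))
  have hfinal := (hmain φ hφm hφi x hcf p (fun m hm n => hp m n hm) hfin).trans
    (mul_le_mul_right hGle _)
  rw [hTeq, mul_left_comm (ENNReal.ofReal D), mul_left_comm (ENNReal.ofReal D),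
    ENNReal.mul_le_mul_iff_right (by simpa using hμ0) ENNReal.ofReal_ne_top,
    ENNReal.mul_le_mul_iff_right (by simpa using pow_ne_zero 2 hb0.ne') ENNReal.ofReal_ne_top] at hfinal
  refine (ENNReal.pow_le_pow_left_iff two_ne_zero).1 ?_
  rw [mul_pow, ← ENNReal.ofReal_pow (by positivity), Real.sq_sqrt (by positivity)]
  calc ENNReal.ofReal (1 / D) * eLpNorm f 2 volume ^ 2
      ≤ ENNReal.ofReal (1 / D) * (ENNReal.ofReal D *
        eLpNorm f 2 (volume.restrict (⋃ j : ℤ, I' j)) ^ 2) := by gcongr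
    _ = _ := by
        rw [← mul_assoc, ← ENNReal.ofReal_mul (by positivity), one_div_mul_cancel hD.ne',
          ENNReal.ofReal_one, one_mul]
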